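/- **Definitions.** Let $0\le\omega_{\min}<\omega_{\max}\le\infty$ and let $[\omega_{\min},\omega_{\max}]$ denote the corresponding closed interval of real numbers. A *gapless spectral density* on it is a measurable function $J\ge 0$, extended by zero, whose support (that of the measure $J(\omega)\,d\omega$) is the whole interval and for which $\int\omega^kJ(\omega)\,d\omega<\infty$ for all $k\ge1$. Put $$D^2(J)=\frac2\pi\int_0^\infty J(\omega)\,\omega\,d\omega,\qquad \Omega^2(J)=\frac{2}{\pi D^2(J)}\int_0^\infty J(\omega)\,\omega^3\,d\omega,\qquad w_J(z)=\frac2\pi\int_0^\infty\frac{J(\omega)\,\omega}{\omega^2-z^2}\,d\omega .$$ A *sequence of residual gapless spectral densities* of the chain mapping of Martinazzo et al. is a sequence $J_0,J_1,J_2,\dots$ of gapless spectral densities on $[\omega_{\min},\omega_{\max}]$ such that, with $w_n=w_{J_n}$, $D_n^2=D^2(J_n)$ and $\Omega_{n+1}^2=\Omega^2(J_n)$, $$w_n(z)=\frac{D_n^2}{\Omega_{n+1}^2-z^2-w_{n+1}(z)}\qquad(n\ge0,\ \pm z\notin[\omega_{\min},\omega_{\max}]),$$ that is, the $w_n$ are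 the successive tails of the continued fraction of $w_0$. For a density $\bar\mu\ge0$ on an interval with finite moments $C_k(d\mu)=\int x^k\bar\mu(x)\,dx$ let $S_{\bar\mu}(z)=\int\frac{\bar\mu(x)\,dx}{z-x}$ be its Stieltjes transform and $\varphi(d\mu;x)=\lim_{\varepsilon\to0^+}[S_{\bar\mu}(x-i\varepsilon)+S_{\bar\mu}(x+i\varepsilon)]$ its reducer. Let $P_n(d\mu;\cdot)$ be real orthonormal polynomials of degree $n$ for $d\mu=\bar\mu(x)\,dx$, and $Q_n(d\mu;x)=\int\frac{P_n(d\mu;t)-P_n(d\mu;x)}{t-x}\,d\mu(t)$ the secondary polynomials. A density $\bar\mu$ is gapless if its support is the whole interval. A sequence of gapless densities $\bar\mu_0,\bar\mu_1,\dots$ on one interval $I$ with $C_0(d\mu_0)=1$ is a *sequence of normalised secondary measures* if, for every $n\ge0$, $\bar\mu_{n+1}=\bar\rho_{n+1}/C_0(d\rho_{n+1})$ for a gapless density $\bar\rho_{n+1}$ on $I$ with $S_{\bar\rho_{n+1}}(z)=z-C_1(d\mu_n)-1/S_{\bar\mu_n}(z)$ for $z\in\mathbb C\setminus I$. Let $d\lambda^1(x)=\pi^{-1}J_0(\sqrt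 x)\,dx$ on $[\omega_{\min}^2,\omega_{\max}^2]$. **Theorem.** Let $J_0,J_1,\dots$ be a sequence of residual gapless spectral densities of the chain mapping of Martinazzo et al. Then the densities $J_n(\sqrt t)/(\pi D_n^2)$, $n\ge0$, on $[\omega_{\min}^2,\omega_{\max}^2]$ form a sequence of normalised secondary measures. Orthonormal polynomials for $d\lambda^1$ exist, and for any choice of them the following holds. For almost every $\omega\in[\omega_{\min},\omega_{\max}]$ the limit defining $\varphi(d\lambda^1;\omega^2)$ exists and, for all $n\ge1$, $$J_n(\omega)=\frac{J_0(\omega)}{\left(P_{n-1}(d\lambda^1;\omega^2)\,\frac{\varphi(d\lambda^1;\omega^2)}{2}-Q_{n-1}(d\lambda^1;\omega^2)\right)^2+J_0(\omega)^2\,P_{n-1}(d\lambda^1;\omega^2)^2},$$ with a non-zero denominator. The same holds, for a given $n\ge1$, at every $\omega$ at which $J_0$ and $J_n$ (extended by zero) are continuous, $J_0(\omega)>0$ and the limit defining $\varphi(d\lambda^1;\omega^2)$ exists. -/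

import Mathlib

open MeasureTheory Filter Topology Polynomial

noncomputable section

namespace ChainMapping

/-- The closed real interval with (possibly infinite) endpoints `a`, `b`. -/
def realInterval (a b : EReal) : Set ℝ := {x : ℝ | a ≤ (x : EReal) ∧ (x : EReal) ≤ b}

/-- The measure `w(x) dx` on the real line. -/
def densityMeasure (w : ℝ → ℝ) : Measure ℝ :=
  (volume : Measure ℝ).withDensity (fun x => ENNReal.ofReal (w x))

/-- The moments `C_k = ∫ x ^ k w(x) dx`. -/
def moment (w : ℝ → ℝ) (k : ℕ) : ℝ := ∫ x : ℝ, x ^ k * w x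

/-- `w(x) dx` is a gapless measure on the nondegenerate interval with endpoints `a < b`:
`w` is nonnegative, all moments are finite, and the support is the whole interval. -/
structure IsGaplessMeasure (a b : EReal) (w : ℝ → ℝ) : Prop where
  lt : a < b
  measurable : Measurable w
  nonneg : ∀ x, 0 ≤ w x
  eq_zero : ∀ x, x ∉ realInterval a b → w x = 0
  moments : ∀ k : ℕ, Integrable (fun x : ℝ => x ^ k * w x)
  support_eq : (densityMeasure w).support = realInterval a b

/-- The Stieltjes transform `S(z) = ∫ w(x) / (z - x) dx`. -/
def stieltjes (w : ℝ → ℝ) (z : ℂ) : ℂ := ∫ x : ℝ, (w x : ℂ) / (z - (x : ℂ))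

/-- `S(x - iε) + S(x + iε)`. -/
def reducerApprox (w : ℝ → ℝ) (x ε : ℝ) : ℂ :=
  stieltjes w ((x : ℂ) - (ε : ℂ) * Complex.I) + stieltjes w ((x : ℂ) + (ε : ℂ) * Complex.I)

/-- The reducer `φ(x) = lim_{ε → 0+} [S(x - iε) + S(x + iε)]` (a real number, since the two
summands are complex conjugate). -/
def reducer (w : ℝ → ℝ) (x : ℝ) : ℝ :=
  (limUnder (𝓝[>] (0 : ℝ)) (reducerApprox w x)).re

/-- The limit that defines the reducer exists at `x`. -/
def HasReducer (w : ℝ → ℝ) (x : ℝ) : Prop :=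
  Tendsto (reducerApprox w x) (𝓝[>] (0 : ℝ)) (𝓝 ((reducer w x : ℝ) : ℂ))

/-- `P 0, P 1, …` are real orthonormal polynomials for `w(x) dx`, `P n` of degree `n`. -/
structure IsOrthonormalPolynomials (w : ℝ → ℝ) (P : ℕ → ℝ[X]) : Prop where
  degree_eq : ∀ n, (P n).degree = n
  orthonormal : ∀ n m, ∫ x : ℝ, (P n).eval x * (P m).eval x * w x = if n = m then 1 else 0

/-- The secondary polynomial `Q(x) = ∫ (p(t) - p(x)) / (t - x) w(t) dt` of a polynomial `p`. -/
def secondaryPoly (w : ℝ → ℝ) (p : ℝ[X]) (x : ℝ) : ℝ :=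
  ∫ t : ℝ, (p.eval t - p.eval x) / (t - x) * w t

/-- `ρ(x) dx` is the secondary measure of the gapless measure `w(x) dx`:
`S_ρ(z) = z - C_1(w) - 1 / S_w(z)` off the support interval. -/
structure IsSecondaryMeasure (a b : EReal) (w ρ : ℝ → ℝ) : Prop where
  gapless : IsGaplessMeasure a b w
  gapless_secondary : IsGaplessMeasure a b ρ
  stieltjes_eq : ∀ z : ℂ, (∀ x ∈ realInterval a b, z ≠ (x : ℂ)) →
    stieltjes ρ z = z - (moment w 1 : ℂ) - 1 / stieltjes w z

/-- `w 0, w 1, …` are the densities of a sequence of normalised secondary measures. -/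
structure IsNormalisedSecondarySequence (a b : EReal) (w : ℕ → ℝ → ℝ) : Prop where
  moment_zero : moment (w 0) 0 = 1
  gapless : ∀ n, IsGaplessMeasure a b (w n)
  step : ∀ n, ∃ ρ : ℝ → ℝ, IsSecondaryMeasure a b (w n) ρ ∧
    ∀ x, w (n + 1) x = ρ x / moment ρ 0

/-- A gapless spectral density on the nondegenerate interval of frequencies with endpoints
`0 ≤ ωmin < ωmax ≤ ∞`, extended by zero. Only the moments of order at least one are required
to be finite. -/
structure IsGaplessSpectralDensity (ωmin ωmax : EReal) (J : ℝ → ℝ) : Prop where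
  nonneg_min : 0 ≤ ωmin
  lt : ωmin < ωmax
  measurable : Measurable J
  nonneg : ∀ ω, 0 ≤ J ω
  eq_zero : ∀ ω, ω ∉ realInterval ωmin ωmax → J ω = 0
  moments : ∀ k : ℕ, 1 ≤ k → Integrable (fun ω : ℝ => ω ^ k * J ω)
  support_eq : (densityMeasure J).support = realInterval ωmin ωmax

/-- `D² = (2/π) ∫₀^∞ J(ω) ω dω`. -/
def couplingSq (J : ℝ → ℝ) : ℝ :=
  2 / Real.pi * ∫ ω in Set.Ioi (0 : ℝ), J ω * ω

/-- `Ω² = 2/(π D²) ∫₀^∞ J(ω) ω³ dω`. -/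
def frequencySq (J : ℝ → ℝ) : ℝ :=
  2 / (Real.pi * couplingSq J) * ∫ ω in Set.Ioi (0 : ℝ), J ω * ω ^ 3

/-- `w(z) = (2/π) ∫₀^∞ J(ω) ω / (ω² - z²) dω`. -/
def selfEnergy (J : ℝ → ℝ) (z : ℂ) : ℂ :=
  2 / (Real.pi : ℂ) *
    ∫ ω in Set.Ioi (0 : ℝ), (J ω : ℂ) * (ω : ℂ) / ((ω : ℂ) ^ 2 - z ^ 2)

/-- `J 0, J 1, …` is the sequence of residual gapless spectral densities of the chain mapping
of Martinazzo et al.: the functions `w_n` attached to the `J n` are the successive tails of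
the continued fraction
`w_0(z) = D_0² / (Ω_1² - z² - D_1² / (Ω_2² - z² - D_2² / (Ω_3² - z² - ⋯)))`
whose coefficients `D_n²`, `Ω_{n+1}²` are computed from `J n`. -/
structure IsResidualSequence (ωmin ωmax : EReal) (J : ℕ → ℝ → ℝ) : Prop where
  gapless : ∀ n, IsGaplessSpectralDensity ωmin ωmax (J n)
  recursion : ∀ (n : ℕ) (z : ℂ),
    (∀ ω ∈ realInterval ωmin ωmax, z ≠ (ω : ℂ) ∧ z ≠ -(ω : ℂ)) →
      selfEnergy (J n) z =
        (couplingSq (J n) : ℂ) /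
          ((frequencySq (J n) : ℂ) - z ^ 2 - selfEnergy (J (n + 1)) z)

/-- The density `M¹(x) = J(√x) / π` (`x ≥ 0`) of the measure `λ¹` attached to `J`. -/
def phononDensity (J : ℝ → ℝ) (x : ℝ) : ℝ :=
  if 0 ≤ x then J (Real.sqrt x) / Real.pi else 0

/-- `(p(ω²) φ(λ¹; ω²) / 2 - q(ω²))² + J(ω)² p(ω²)²`, where `q` is the secondary polynomial of
`p` for `λ¹`. -/
def residualDenominator (J : ℝ → ℝ) (p : ℝ[X]) (ω : ℝ) : ℝ :=
  (p.eval (ω ^ 2) * (reducer (phononDensity J) (ω ^ 2) / 2)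
      - secondaryPoly (phononDensity J) p (ω ^ 2)) ^ 2
    + J ω ^ 2 * p.eval (ω ^ 2) ^ 2

end ChainMapping

end

/-! Substituting `t = ω²` gives `w_n(z) = -S_n(z²)`, where `S_n` is the Stieltjes transform of
`M_n(t) = J_n(√t)/π`, of mass `b_n = D_n²` and mean `a_n = Ω_{n+1}²`. The recursion becomes `S_n (z
- a_n - S_{n+1}) = b_n`, which after division of `M_n` by `b_n` is the defining relation of
normalised secondary measures.

Let `q_n / p_n` be the convergents, with `p_n` monic. Induction gives `p_n S_0 - q_n = S_0 S_1 ⋯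
S_n`, and the transform of `p_n M_0` is this same product. It decays like `b_0 ⋯ b_n / z^(n+1)`
along the imaginary axis, so reading off moments shows that `p_n` is orthogonal to lower degrees
with squared norm `b_0 ⋯ b_n`. Hence any orthonormal `P_n` is a constant multiple of `p_n`, and its
secondary polynomial is the same multiple of `q_n` (`orthonormal_eq_C_mul`,
`secondaryPoly_convergentDen`).

Now `S_{n+1} = (p_{n+1} S_0 - q_{n+1}) / (p_n S_0 - q_n)`. Since `q_{n+1} p_n - p_{n+1} q_n = b_0 ⋯
b_n`, the limits from the lower half-plane satisfy `Im S_{n+1} = b_0 ⋯ b_n Im S_0 / |p_n S_0 -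
q_n|²` (`im_limit_mul_normSq`). With `S_0 = φ/2 + iπM_0` and `Im S_{n+1} = πM_{n+1}` at the
boundary, this is the formula.

The analytic input is the boundary behaviour. Imaginary parts are Poisson integrals and converge at
Lebesgue points. Finite limits of `S_n` exist almost everywhere by Fatou's theorem applied to
`1/(S_n + i)`, together with a proof that this function tends to zero only on a null set. No limit
of `S_n` is zero there, because the recursion would give `b_n = 0`. At a point of continuity with
`J_0 > 0`, continuity replaces the Lebesgue point property and `Im S_0 > 0` keeps the denominator
nonzero. -/

namespace ChainMapping

/-! ### Poisson integrals at Lebesgue points -/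

/-- `π` times the Poisson kernel of the half-plane at height `y`. -/
noncomputable def poisson (y u : ℝ) : ℝ := y / (u ^ 2 + y ^ 2)

/-- `x` is a Lebesgue point of `f`. -/
def IsLebesguePoint (f : ℝ → ℂ) (x : ℝ) : Prop :=
  Tendsto (fun r => (∫⁻ t in Metric.closedBall x r, ‖f t - f x‖ₑ) / volume (Metric.closedBall x r))
    (𝓝[>] (0 : ℝ)) (𝓝 0)

lemma ae_isLebesguePoint {f : ℝ → ℂ} (hf : LocallyIntegrable f) :
    ∀ᵐ x : ℝ, IsLebesguePoint f x := by
  filter_upwards [(IsUnifLocDoublingMeasure.vitaliFamily (volume : Measure ℝ)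
    1).ae_tendsto_lintegral_enorm_sub_div hf] with x hx
  refine hx.comp (IsUnifLocDoublingMeasure.tendsto_closedBall_filterAt volume (K := 1)
    (fun _ : ℝ => x) (fun r => r) tendsto_id ?_)
  filter_upwards [self_mem_nhdsWithin] with r hr
  simpa using hr.le

lemma isLebesguePoint_of_continuousAt {f : ℝ → ℂ} {x : ℝ} (hf : ContinuousAt f x) :
    IsLebesguePoint f x := by
  rw [IsLebesguePoint, ENNReal.tendsto_nhds_zero]
  intro η hη
  have h1 : ∀ᶠ t in 𝓝 x, ‖f t - f x‖ₑ ≤ η := by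
    have h2 : Tendsto (fun t => ‖f t - f x‖ₑ) (𝓝 x) (𝓝 0) := by
      have h3 : Tendsto (fun t => f t - f x) (𝓝 x) (𝓝 (f x - f x)) := hf.sub tendsto_const_nhds
      rw [sub_self] at h3
      have h4 := (continuous_enorm.tendsto (0 : ℂ)).comp h3
      rw [enorm_zero] at h4
      exact h4
    exact (ENNReal.tendsto_nhds_zero.1 h2) η hη
  obtain ⟨r0, hr0, hb⟩ := Metric.eventually_nhds_iff_ball.1 h1
  filter_upwards [Ioo_mem_nhdsGT hr0] with r hr
  refine ENNReal.div_le_of_le_mul ?_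
  calc ∫⁻ t in Metric.closedBall x r, ‖f t - f x‖ₑ
      ≤ ∫⁻ t in Metric.closedBall x r, η := by
        refine setLIntegral_mono' Metric.isClosed_closedBall.measurableSet fun t ht => ?_
        exact hb t (Metric.closedBall_subset_ball hr.2 ht)
    _ = η * volume (Metric.closedBall x r) := by simp

lemma poisson_nonneg {y : ℝ} (hy : 0 < y) (u : ℝ) : 0 ≤ poisson y u := by
  unfold poisson; positivity

lemma continuous_poisson {y : ℝ} (hy : 0 < y) : Continuous (poisson y) := by
  unfold poisson
  refine continuous_const.div (by fun_prop) fun u => by positivity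

lemma poisson_eq {y : ℝ} (hy : 0 < y) (u : ℝ) :
    poisson y u = y⁻¹ * (1 + (y⁻¹ * u) ^ 2)⁻¹ := by
  unfold poisson
  field_simp
  ring

lemma integrable_poisson {y : ℝ} (hy : 0 < y) : Integrable (poisson y) := by
  have h := (integrable_inv_one_add_sq.comp_mul_left' (inv_ne_zero hy.ne')).const_mul y⁻¹
  exact h.congr (Eventually.of_forall fun u => (poisson_eq hy u).symm)

lemma integral_poisson {y : ℝ} (hy : 0 < y) : ∫ u, poisson y u = Real.pi := by
  simp_rw [poisson_eq hy]
  rw [integral_const_mul, Measure.integral_comp_mul_left (fun u => (1 + u ^ 2)⁻¹),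
    integral_univ_inv_one_add_sq]
  simp [abs_of_pos hy]
  field_simp

lemma integral_poisson_sub {y : ℝ} (hy : 0 < y) (x : ℝ) : ∫ t, poisson y (x - t) = Real.pi := by
  rw [integral_sub_left_eq_self (poisson y) volume x, integral_poisson hy]

/-- The kernel is even and decreasing in `|x - t|`, so its superlevel sets are balls about `x`,
possibly empty (radius `-1`). This prepares the layer-cake argument. -/
lemma setOf_le_poisson_sub {y s : ℝ} (hy : 0 < y) (hs : 0 < s) (x : ℝ) :
    ∃ r, {t | s ≤ poisson y (x - t)} = Metric.closedBall x r := by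
  by_cases h : s * y ^ 2 ≤ y
  · refine ⟨Real.sqrt (y / s - y ^ 2), ?_⟩
    ext t
    have h0 : 0 ≤ y / s - y ^ 2 := by
      rw [sub_nonneg, le_div_iff₀ hs]; linarith
    rw [Metric.mem_closedBall, dist_comm, Real.dist_eq, Set.mem_ofPred_eq, poisson,
      le_div_iff₀ (by positivity)]
    constructor
    · intro h
      refine Real.le_sqrt_of_sq_le ?_
      rw [sq_abs, le_sub_iff_add_le, le_div_iff₀ hs]; linarith
    · intro h
      have := (Real.le_sqrt (abs_nonneg _) h0).1 h
      rw [sq_abs, le_sub_iff_add_le, le_div_iff₀ hs] at this; linarith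
  · refine ⟨-1, ?_⟩
    rw [Metric.closedBall_eq_empty.2 (by norm_num), Set.eq_empty_iff_forall_notMem]
    intro t ht
    rw [Set.mem_ofPred_eq, poisson, le_div_iff₀ (by positivity)] at ht
    nlinarith [sq_nonneg (x - t)]

/-- Layer-cake formula: both integrals are integrals over the heights of measures of centred balls,
where `μ` is dominated by `η` times Lebesgue measure. -/
lemma lintegral_poisson_le {μ : Measure ℝ} {y x : ℝ} {η : ENNReal} (hη : η ≠ ⊤) (hy : 0 < y)
    (hμ : ∀ r, μ (Metric.closedBall x r) ≤ η * volume (Metric.closedBall x r)) :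
    ∫⁻ t, ENNReal.ofReal (poisson y (x - t)) ∂μ ≤ η * ENNReal.ofReal Real.pi := by
  have hc : Continuous fun t => poisson y (x - t) :=
    (continuous_poisson hy).comp (by fun_prop)
  have h1 : ∫⁻ t, ENNReal.ofReal (poisson y (x - t)) = ENNReal.ofReal Real.pi := by
    rw [← integral_poisson_sub hy x, ofReal_integral_eq_lintegral_ofReal]
    · exact (integrable_poisson hy).comp_sub_left x
    · exact Eventually.of_forall fun t => poisson_nonneg hy _
  rw [← h1, lintegral_eq_lintegral_meas_le μ
    (Eventually.of_forall fun t => poisson_nonneg hy _) hc.aemeasurable,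
    lintegral_eq_lintegral_meas_le volume
    (Eventually.of_forall fun t => poisson_nonneg hy _) hc.aemeasurable,
    ← lintegral_const_mul' _ _ hη]
  refine setLIntegral_mono' measurableSet_Ioi fun s hs => ?_
  obtain ⟨r, hr⟩ := setOf_le_poisson_sub hy hs x
  rw [hr]
  exact hμ r

/-- Cutting off at `r0` makes the small-radius bound valid at every radius, as the layer-cake
comparison demands: beyond `r0` the left side no longer grows. -/
lemma IsLebesguePoint.exists_bound {f : ℝ → ℂ} {x : ℝ} (h : IsLebesguePoint f x) {η : ENNReal}
    (hη : 0 < η) : ∃ r0 > 0, ∀ r,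
      ∫⁻ t in Metric.closedBall x r0 ∩ Metric.closedBall x r, ‖f t - f x‖ₑ
        ≤ η * volume (Metric.closedBall x r) := by
  have h1 := ENNReal.tendsto_nhds_zero.1 h η hη
  obtain ⟨r1, hr1, hb⟩ := (mem_nhdsGT_iff_exists_Ioo_subset).1 h1
  have hr1' : (0 : ℝ) < r1 := hr1
  have key : ∀ r, 0 < r → r < r1 → ∫⁻ t in Metric.closedBall x r, ‖f t - f x‖ₑ
      ≤ η * volume (Metric.closedBall x r) := by
    intro r h0 h2
    have h3 : (∫⁻ t in Metric.closedBall x r, ‖f t - f x‖ₑ) / volume (Metric.closedBall x r) ≤ η :=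
      hb ⟨h0, h2⟩
    rwa [ENNReal.div_le_iff] at h3
    · simp [h0]
    · exact measure_closedBall_lt_top.ne
  refine ⟨r1 / 2, by positivity, fun r => ?_⟩
  rcases le_or_gt r 0 with h0 | h0
  · have : volume (Metric.closedBall x r) = 0 := by simp [h0]
    rw [this, mul_zero, nonpos_iff_eq_zero]
    exact setLIntegral_measure_zero _ _ (measure_mono_null Set.inter_subset_right this)
  rcases le_or_gt r (r1 / 2) with h2 | h2
  · rw [Set.inter_eq_right.2 (Metric.closedBall_subset_closedBall h2)]
    exact key r h0 (by linarith)
  · rw [Set.inter_eq_left.2 (Metric.closedBall_subset_closedBall h2.le)]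
    refine (key _ (by positivity) (by linarith)).trans ?_
    gcongr

/-- Away from `x` this bounds the Poisson kernel of height `y` by `y C / (1 + t²)`, so the far part
of a Poisson integral vanishes with `y`. -/
lemma exists_one_add_sq_le {x r : ℝ} (hr : 0 < r) :
    ∃ C > 0, ∀ t, r < |t - x| → 1 + t ^ 2 ≤ C * (x - t) ^ 2 := by
  refine ⟨2 + (1 + 2 * x ^ 2) / r ^ 2, by positivity, fun t ht => ?_⟩
  have h1 : r ^ 2 ≤ (x - t) ^ 2 := by
    rw [← sq_abs (x - t), abs_sub_comm]; gcongr
  have h2 : 1 + 2 * x ^ 2 ≤ (1 + 2 * x ^ 2) / r ^ 2 * (x - t) ^ 2 := by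
    rw [div_mul_eq_mul_div, le_div_iff₀ (by positivity)]
    gcongr
  nlinarith [sq_nonneg (x - t + x)]

lemma exists_poisson_bound (x : ℝ) {y : ℝ} (hy : 0 < y) :
    ∃ c, ∀ t, ‖((poisson y (x - t) * (1 + t ^ 2) : ℝ) : ℂ)‖ ≤ c := by
  refine ⟨y * (2 + (1 + 2 * x ^ 2) / y ^ 2), fun t => ?_⟩
  rw [Complex.norm_real, Real.norm_of_nonneg (mul_nonneg (poisson_nonneg hy _) (by positivity)),
    poisson, div_mul_eq_mul_div, div_le_iff₀ (by positivity), mul_assoc]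
  gcongr
  have h2 : 1 + 2 * x ^ 2 ≤ (1 + 2 * x ^ 2) / y ^ 2 * ((x - t) ^ 2 + y ^ 2) := by
    rw [div_mul_eq_mul_div, le_div_iff₀ (by positivity)]
    gcongr
    nlinarith [sq_nonneg (x - t)]
  nlinarith [sq_nonneg (x - t + x), sq_nonneg y]

lemma integrable_poisson_mul {f : ℝ → ℂ} (hf : Integrable fun t => ((1 + t ^ 2)⁻¹ : ℝ) * f t)
    {y : ℝ} (hy : 0 < y) (x : ℝ) : Integrable fun t => (poisson y (x - t) : ℂ) * f t := by
  have hc : Continuous fun t : ℝ => ((poisson y (x - t) * (1 + t ^ 2) : ℝ) : ℂ) := by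
    have : Continuous fun t => poisson y (x - t) := (continuous_poisson hy).comp (by fun_prop)
    fun_prop
  obtain ⟨c, hb⟩ := exists_poisson_bound x hy
  refine (hf.bdd_mul hc.aestronglyMeasurable (Eventually.of_forall hb)).congr
    (Eventually.of_forall fun t => ?_)
  have : (1 + t ^ 2 : ℝ) ≠ 0 := by positivity
  have := Complex.ofReal_ne_zero.2 this
  simp only [Complex.ofReal_mul, Complex.ofReal_inv]
  field_simp

lemma locallyIntegrable_of_weighted {f : ℝ → ℂ}
    (hf : Integrable fun t => ((1 + t ^ 2)⁻¹ : ℝ) * f t) : LocallyIntegrable f := by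
  have hc : Continuous fun t : ℝ => ((1 + t ^ 2 : ℝ) : ℂ) := by fun_prop
  have h := hf.locallyIntegrable.continuous_mul hc
  convert! h using 2 with t
  have : (1 + t ^ 2 : ℝ) ≠ 0 := by positivity
  have := Complex.ofReal_ne_zero.2 this
  push_cast at this ⊢
  field_simp

lemma IsLebesguePoint.tendsto_poisson {f : ℝ → ℂ} {x : ℝ}
    (hf : Integrable fun t => ((1 + t ^ 2)⁻¹ : ℝ) * f t) (h : IsLebesguePoint f x) :
    Tendsto (fun y => ∫ t, (poisson y (x - t) : ℂ) * f t) (𝓝[>] (0 : ℝ)) (𝓝 (Real.pi * f x)) := by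
  have hg : Integrable fun t => ((1 + t ^ 2)⁻¹ : ℝ) * (f t - f x) := by
    have h1 : Integrable fun t : ℝ => ((1 + t ^ 2)⁻¹ : ℝ) * f x :=
      (integrable_inv_one_add_sq.ofReal).mul_const (f x)
    refine (hf.sub h1).congr (Eventually.of_forall fun t => ?_)
    simp [mul_sub]
  have hmeas : AEMeasurable fun t => ‖f t - f x‖ₑ :=
    ((locallyIntegrable_of_weighted hf).aestronglyMeasurable.sub
      aestronglyMeasurable_const).enorm
  have hdiff : ∀ y > 0, (∫ t, (poisson y (x - t) : ℂ) * f t) - Real.pi * f x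
      = ∫ t, (poisson y (x - t) : ℂ) * (f t - f x) := by
    intro y hy
    have h1 : Integrable fun t => (poisson y (x - t) : ℂ) * f x :=
      (((integrable_poisson hy).comp_sub_left x).ofReal).mul_const (f x)
    have h2 : ∫ t, (poisson y (x - t) : ℂ) * f x = Real.pi * f x := by
      rw [integral_mul_const, integral_complex_ofReal, integral_poisson_sub hy]
    rw [← h2, ← integral_sub (integrable_poisson_mul hf hy x) h1]
    simp [mul_sub]
  rw [tendsto_iff_norm_sub_tendsto_zero]
  suffices H : Tendsto (fun y => ∫⁻ t, ENNReal.ofReal (poisson y (x - t)) * ‖f t - f x‖ₑ)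
      (𝓝[>] (0 : ℝ)) (𝓝 0) by
    rw [← ENNReal.toReal_zero]
    have h0 := (ENNReal.tendsto_toReal ENNReal.zero_ne_top).comp H
    refine squeeze_zero' (Eventually.of_forall fun _ => norm_nonneg _) ?_ h0
    filter_upwards [self_mem_nhdsWithin] with y hy
    rw [hdiff y hy]
    refine (norm_integral_le_lintegral_norm _).trans (le_of_eq ?_)
    rw [Function.comp_apply]
    congr 1
    refine lintegral_congr fun t => ?_
    rw [norm_mul, Complex.norm_real, Real.norm_of_nonneg (poisson_nonneg hy _),
      ENNReal.ofReal_mul (poisson_nonneg hy _), ofReal_norm]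
  rw [ENNReal.tendsto_nhds_zero]
  intro η hη
  -- The minimum with `1` keeps `δ` finite even when `η = ⊤`.
  obtain ⟨δ, hδ0, hδ⟩ : ∃ δ : ENNReal, 0 < δ ∧ δ ≠ ⊤ ∧ δ * ENNReal.ofReal Real.pi ≤ η / 2 := by
    have hp : ENNReal.ofReal Real.pi ≠ 0 := by simp [Real.pi_pos]
    refine ⟨min 1 (η / 2 / ENNReal.ofReal Real.pi), ?_, ?_, ?_⟩
    · refine lt_min one_pos (ENNReal.div_pos (ENNReal.half_pos hη.ne').ne' ENNReal.ofReal_ne_top)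
    · exact ne_top_of_le_ne_top ENNReal.one_ne_top (min_le_left _ _)
    · refine (mul_le_mul_left (min_le_right _ _) _).trans ?_
      rw [ENNReal.div_mul_cancel hp ENNReal.ofReal_ne_top]
  obtain ⟨r0, hr0, hb⟩ := h.exists_bound hδ0
  obtain ⟨C, hC, hCb⟩ := exists_one_add_sq_le (x := x) hr0
  set T := ∫⁻ t, ‖((1 + t ^ 2)⁻¹ : ℝ) * (f t - f x)‖ₑ with hT
  have hTfin : T ≠ ⊤ := hg.2.ne
  have hsmall : ∀ᶠ y in 𝓝[>] (0 : ℝ), ENNReal.ofReal (y * C) * T ≤ η / 2 := by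
    have h1 : Tendsto (fun y : ℝ => ENNReal.ofReal (y * C) * T) (𝓝[>] 0) (𝓝 (0 * T)) := by
      refine ENNReal.Tendsto.mul_const ?_ (Or.inr hTfin)
      rw [← ENNReal.ofReal_zero]
      refine ENNReal.tendsto_ofReal ?_
      have : Tendsto (fun y : ℝ => y * C) (𝓝 0) (𝓝 (0 * C)) := tendsto_id.mul_const C
      rw [zero_mul] at this
      exact this.mono_left nhdsWithin_le_nhds
    rw [zero_mul] at h1
    exact ENNReal.tendsto_nhds_zero.1 h1 _ (ENNReal.half_pos hη.ne')
  filter_upwards [self_mem_nhdsWithin, hsmall] with y hy hsm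
  have hy : 0 < y := hy
  rw [← lintegral_add_compl _ (Metric.isClosed_closedBall (x := x) (ε := r0)).measurableSet,
    ← ENNReal.add_halves η]
  refine add_le_add ?_ ?_
  -- Near `x`, the density `‖f - f x‖` cut off at `r0` is a measure to which the layer-cake bound
  -- applies.
  · set μ := (volume.restrict (Metric.closedBall x r0)).withDensity (fun t => ‖f t - f x‖ₑ) with hμ
    have h1 : ∫⁻ t in Metric.closedBall x r0, ENNReal.ofReal (poisson y (x - t)) * ‖f t - f x‖ₑ
        = ∫⁻ t, ENNReal.ofReal (poisson y (x - t)) ∂μ := by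
      have hc : Continuous fun t => poisson y (x - t) :=
        (continuous_poisson hy).comp (by fun_prop)
      rw [hμ, lintegral_withDensity_eq_lintegral_mul₀ hmeas.restrict
        (hc.measurable.ennreal_ofReal.aemeasurable)]
      refine lintegral_congr fun t => ?_
      simp [mul_comm]
    rw [h1]
    refine (lintegral_poisson_le hδ.1 hy fun r => ?_).trans hδ.2
    rw [hμ, withDensity_apply _ Metric.isClosed_closedBall.measurableSet,
      Measure.restrict_restrict Metric.isClosed_closedBall.measurableSet, Set.inter_comm]
    exact hb r
  -- Far from `x`, the kernel is at most `y C` times the weight `1 / (1 + t²)`.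
  · refine le_trans ?_ hsm
    rw [hT, ← lintegral_const_mul' _ _ ENNReal.ofReal_ne_top]
    refine (setLIntegral_mono' Metric.isClosed_closedBall.measurableSet.compl
      (fun t ht => ?_)).trans (setLIntegral_le_lintegral _ _)
    rw [enorm_mul, ← mul_assoc]
    gcongr
    rw [← ofReal_norm, Complex.norm_real, Real.norm_of_nonneg (by positivity),
      ← ENNReal.ofReal_mul (by positivity)]
    refine ENNReal.ofReal_le_ofReal ?_
    have h3 := hCb t (by simpa [Real.dist_eq] using ht)
    rw [poisson, ← div_eq_mul_inv, div_le_div_iff₀ (by positivity) (by positivity), mul_assoc]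
    gcongr
    nlinarith [mul_pos hC (pow_pos hy 2)]

/-! ### Poisson's formula in the lower half-plane -/

lemma isOpen_im_lt (η : ℝ) : IsOpen {z : ℂ | z.im < η} :=
  isOpen_lt Complex.continuous_im continuous_const

/-- Cauchy's theorem on the rectangle `[-R, R] × [-R, 0]`: the three lower sides have total length
`4R` and the integrand is `O(R⁻²)` on them. -/
lemma integral_eq_zero_of_lower_decay {F : ℂ → ℂ} {η C R0 : ℝ} (hη : 0 < η)
    (hF : DifferentiableOn ℂ F {z | z.im < η})
    (hb : ∀ z : ℂ, z.im ≤ 0 → R0 ≤ ‖z‖ → ‖F z‖ ≤ C / ‖z‖ ^ 2)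
    (hi : Integrable fun x : ℝ => F x) : ∫ x : ℝ, F x = 0 := by
  have hlim := intervalIntegral_tendsto_integral hi tendsto_neg_atTop_atBot tendsto_id
  have h0 : Tendsto (fun R : ℝ => ∫ x in (-R)..R, F x) atTop (𝓝 0) := by
    have hz : Tendsto (fun R : ℝ => (4 * |C|) * R⁻¹) atTop (𝓝 ((4 * |C|) * 0)) :=
      tendsto_inv_atTop_zero.const_mul _
    rw [mul_zero] at hz
    refine squeeze_zero_norm' ?_ hz
    filter_upwards [eventually_ge_atTop (max R0 1)] with R hR
    have hR0 : R0 ≤ R := (le_max_left _ _).trans hR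
    have hR1 : 0 < R := lt_of_lt_of_le one_pos ((le_max_right _ _).trans hR)
    have hsq : ∀ z : ℂ, z.im ≤ 0 → R ≤ ‖z‖ → ‖F z‖ ≤ |C| / R ^ 2 := by
      intro z hz hzR
      refine (hb z hz (hR0.trans hzR)).trans ?_
      gcongr
      exact le_abs_self C
    have key := Complex.integral_boundary_rect_eq_zero_of_differentiableOn F
      (⟨-R, -R⟩ : ℂ) (⟨R, 0⟩ : ℂ) (hF.mono ?_)
    · simp only [Complex.ofReal_zero, zero_mul, add_zero] at key
      set I1 := ∫ x : ℝ in (-R)..R, F (x + (-R : ℝ) * Complex.I)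
      set I2 := ∫ x : ℝ in (-R)..R, F x
      set I3 := ∫ y : ℝ in (-R)..0, F ((R : ℝ) + y * Complex.I)
      set I4 := ∫ y : ℝ in (-R)..0, F ((-R : ℝ) + y * Complex.I)
      have e2 : I2 = I1 + Complex.I • I3 - Complex.I • I4 := by linear_combination -key
      have hb1 : ‖I1‖ ≤ |C| / R ^ 2 * |R - -R| := by
        refine intervalIntegral.norm_integral_le_of_norm_le_const fun x _ => hsq _ ?_ ?_
        · simp [hR1.le]
        · refine le_trans ?_ (Complex.abs_im_le_norm _)
          simp [abs_of_pos hR1]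
      have hb3 : ‖I3‖ ≤ |C| / R ^ 2 * |0 - -R| := by
        refine intervalIntegral.norm_integral_le_of_norm_le_const fun x hx => hsq _ ?_ ?_
        · rw [Set.uIoc_of_le (by linarith)] at hx
          simpa using hx.2
        · refine le_trans ?_ (Complex.abs_re_le_norm _)
          simp [abs_of_pos hR1]
      have hb4 : ‖I4‖ ≤ |C| / R ^ 2 * |0 - -R| := by
        refine intervalIntegral.norm_integral_le_of_norm_le_const fun x hx => hsq _ ?_ ?_
        · rw [Set.uIoc_of_le (by linarith)] at hx
          simpa using hx.2
        · refine le_trans ?_ (Complex.abs_re_le_norm _)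
          simp [abs_of_pos hR1]
      have ht : ‖I2‖ ≤ ‖I1‖ + ‖I3‖ + ‖I4‖ := by
        rw [e2]
        refine (norm_sub_le _ _).trans ?_
        have := norm_add_le I1 (Complex.I • I3)
        rw [norm_smul, Complex.norm_I, one_mul] at *
        linarith
      rw [show |R - -R| = 2 * R by rw [abs_of_pos] <;> linarith] at hb1
      rw [show |0 - -R| = R by rw [abs_of_pos] <;> linarith] at hb3 hb4
      calc ‖I2‖ ≤ |C| / R ^ 2 * (2 * R) + |C| / R ^ 2 * R + |C| / R ^ 2 * R := by linarith
        _ = 4 * |C| * R⁻¹ := by field_simp; ring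
    · intro z hz
      have h2 := hz.2
      simp only [Set.mem_preimage, Set.uIcc_of_le (neg_nonpos.2 hR1.le)] at h2
      exact lt_of_le_of_lt h2.2 hη
  exact tendsto_nhds_unique hlim h0

/-- Poisson's formula for a bounded holomorphic function in the lower half-plane. -/
lemma poisson_formula {F : ℂ → ℂ} {η C : ℝ} (hη : 0 < η)
    (hF : DifferentiableOn ℂ F {z | z.im < η}) (hb : ∀ z : ℂ, z.im ≤ 0 → ‖F z‖ ≤ C)
    (x : ℝ) {y : ℝ} (hy : 0 < y) :
    ∫ t : ℝ, (poisson y (x - t) : ℂ) * F t = Real.pi * F (x - y * Complex.I) := by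
  set z0 : ℂ := x - y * Complex.I with hz0
  set w0 : ℂ := x + y * Complex.I with hw0
  have him : z0.im = -y := by simp [hz0]
  have hwim : w0.im = y := by simp [hw0]
  have hFc : Continuous fun t : ℝ => F t := by
    refine hF.continuousOn.comp_continuous Complex.continuous_ofReal fun t => ?_
    simpa using hη
  have hC : 0 ≤ C := (norm_nonneg _).trans (hb 0 (by simp))
  have hint1 : Integrable fun t : ℝ => (poisson y (x - t) : ℂ) * F t := by
    refine (((integrable_poisson hy).comp_sub_left x).ofReal).mul_bdd (c := C)
      hFc.aestronglyMeasurable (Eventually.of_forall fun t => hb _ (by simp))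
  have hint2 : Integrable fun t : ℝ => (poisson y (x - t) : ℂ) * F z0 :=
    (((integrable_poisson hy).comp_sub_left x).ofReal).mul_const _
  -- Since `(t - z0)(t - w0) = (x - t)² + y²`, the difference of the two sides of Poisson's formula
  -- is `y` times the integral of this quotient. It is holomorphic across the real line from below,
  -- as `dslope` removes the singularity at `z0` and `w0` lies above, and it decays quadratically.
  have hGeq : ∀ t : ℝ, dslope F z0 t / (t - w0)
      = (y : ℂ)⁻¹ * ((poisson y (x - t) : ℂ) * F t - (poisson y (x - t) : ℂ) * F z0) := by
    intro t
    have h1 : (t : ℂ) ≠ z0 := fun h => by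
      have := congrArg Complex.im h; rw [him] at this; simp at this; linarith
    have h2 : (t : ℂ) ≠ w0 := fun h => by
      have := congrArg Complex.im h; rw [hwim] at this; simp at this; linarith
    have h3 : ((x - t) ^ 2 + y ^ 2 : ℂ) = (t - z0) * (t - w0) := by
      rw [hz0, hw0]; ring_nf; rw [Complex.I_sq]; ring
    rw [dslope_of_ne _ h1, slope_def_field, poisson]
    push_cast
    rw [h3]
    have := sub_ne_zero.2 h1
    have := sub_ne_zero.2 h2
    have hy' : (y : ℂ) ≠ 0 := Complex.ofReal_ne_zero.2 hy.ne'
    field_simp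
  have hmain : ∫ t : ℝ, dslope F z0 t / (t - w0) = 0 := by
    -- For `‖z‖ ≥ R0` both denominators are at least `‖z‖ / 2`, and the numerator is at most `2C`.
    refine integral_eq_zero_of_lower_decay (F := fun z => dslope F z0 z / (z - w0))
      (η := min η y) (C := 8 * C) (R0 := 2 * ‖z0‖ + 2 * ‖w0‖ + 1) (lt_min hη hy) ?_ ?_ ?_
    · refine DifferentiableOn.div ?_ (by fun_prop) ?_
      · refine (((Complex.differentiableOn_dslope
          ((isOpen_im_lt η).mem_nhds ?_)).2 hF).mono ?_)
        · show z0.im < η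
          rw [him]; linarith
        · exact fun z (hz : z.im < min η y) => show z.im < η from lt_of_lt_of_le hz (min_le_left _ _)
      · intro z hz h
        have : z.im < y := lt_of_lt_of_le hz (min_le_right _ _)
        rw [sub_eq_zero.1 h, hwim] at this
        exact lt_irrefl _ this
    · intro z hz hzR
      have hn0 := norm_nonneg z0
      have hn1 := norm_nonneg w0
      have a1 : ‖z‖ / 2 ≤ ‖z - z0‖ := by
        have := norm_sub_norm_le z z0; linarith
      have a2 : ‖z‖ / 2 ≤ ‖z - w0‖ := by
        have := norm_sub_norm_le z w0; linarith
      have hzpos : 0 < ‖z‖ := by linarith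
      have hne : z ≠ z0 := fun h => by
        rw [h, sub_self, norm_zero] at a1
        rw [h] at hzpos; linarith
      rw [dslope_of_ne _ hne, slope_def_field, norm_div, norm_div, div_div]
      calc ‖F z - F z0‖ / (‖z - z0‖ * ‖z - w0‖) ≤ (2 * C) / (‖z‖ / 2 * (‖z‖ / 2)) := by
            gcongr
            refine (norm_sub_le _ _).trans ?_
            have := hb z hz
            have := hb z0 (by rw [him]; linarith)
            linarith
        _ = 8 * C / ‖z‖ ^ 2 := by field_simp; ring
    · refine Integrable.congr ((hint1.sub hint2).const_mul (y : ℂ)⁻¹)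
        (Eventually.of_forall fun t => (hGeq t).symm)
  simp_rw [hGeq] at hmain
  rw [integral_const_mul, integral_sub hint1 hint2, integral_mul_const, integral_complex_ofReal,
    integral_poisson_sub hy] at hmain
  have hy' : (y : ℂ)⁻¹ ≠ 0 := inv_ne_zero (Complex.ofReal_ne_zero.2 hy.ne')
  exact sub_eq_zero.1 ((mul_eq_zero.1 hmain).resolve_left hy')

/-! ### Fatou's theorem -/

/-- Banach–Alaoglu, with the limit taken along an ultrafilter so that no subsequence has to be
extracted. -/
lemma exists_weak_limit {E : Type*} [NormedAddCommGroup E] [InnerProductSpace ℂ E]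
    [CompleteSpace E] {u : ℕ → E} {c : ℝ} (hu : ∀ n, ‖u n‖ ≤ c) (U : Ultrafilter ℕ) :
    ∃ h : E, ∀ g : E, Tendsto (fun n => inner ℂ g (u n)) U (𝓝 (inner ℂ g h)) := by
  have hcomp := WeakDual.isCompact_closedBall (𝕜 := ℂ) (E := E) 0 c
  let φ : ℕ → WeakDual ℂ E := fun n =>
    StrongDual.toWeakDual (InnerProductSpace.toDual ℂ E (u n))
  have hmem : (↑(U.map φ) : Filter (WeakDual ℂ E)) ≤ 𝓟
      (⇑WeakDual.toStrongDual ⁻¹' Metric.closedBall 0 c) := by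
    rw [Ultrafilter.coe_map, le_principal_iff, mem_map]
    refine Eventually.of_forall fun n => ?_
    show WeakDual.toStrongDual (φ n) ∈ Metric.closedBall 0 c
    rw [mem_closedBall_zero_iff]
    simpa [φ] using hu n
  obtain ⟨ψ, -, hψ⟩ := hcomp.ultrafilter_le_nhds _ hmem
  refine ⟨(InnerProductSpace.toDual ℂ E).symm (WeakDual.toStrongDual ψ), fun g => ?_⟩
  have h1 : Tendsto (fun n => φ n g) U (𝓝 (ψ g)) :=
    ((WeakDual.eval_continuous g).tendsto ψ).comp hψ
  have h2 := (Complex.continuous_conj.tendsto _).comp h1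
  refine (h2.congr fun n => ?_).trans (le_of_eq ?_)
  · simp only [Function.comp_apply]
    exact inner_conj_symm g (u n)
  · congr 1
    rw [← inner_conj_symm, InnerProductSpace.toDual_symm_apply]
    rfl

lemma lower_shift_mem {t δ : ℝ} (hδ : 0 < δ) :
    ((t : ℂ) - δ * Complex.I) ∈ {z : ℂ | z.im < 0} := by
  simpa using hδ

/-- The measure `dt / (1 + t²)`. -/
noncomputable def cauchyWeight : Measure ℝ :=
  volume.withDensity fun t => ENNReal.ofReal ((1 + t ^ 2)⁻¹)

lemma integral_cauchyWeight (g : ℝ → ℂ) :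
    ∫ t, g t ∂cauchyWeight = ∫ t : ℝ, ((1 + t ^ 2)⁻¹ : ℝ) * g t := by
  rw [cauchyWeight, integral_withDensity_eq_integral_toReal_smul (by fun_prop)
    (Eventually.of_forall fun t => ENNReal.ofReal_lt_top)]
  refine integral_congr_ae (Eventually.of_forall fun t => ?_)
  have : (0 : ℝ) ≤ (1 + t ^ 2)⁻¹ := by positivity
  simp only [ENNReal.toReal_ofReal this, Complex.real_smul]

instance : IsFiniteMeasure cauchyWeight :=
  isFiniteMeasure_withDensity_ofReal integrable_inv_one_add_sq.2

lemma integrable_cauchyWeight_iff {g : ℝ → ℂ} :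
    Integrable g cauchyWeight ↔ Integrable fun t : ℝ => ((1 + t ^ 2)⁻¹ : ℝ) * g t := by
  rw [cauchyWeight, integrable_withDensity_iff_integrable_smul' (by fun_prop)
    (Eventually.of_forall fun t => ENNReal.ofReal_lt_top)]
  refine integrable_congr (Eventually.of_forall fun t => ?_)
  have : (0 : ℝ) ≤ (1 + t ^ 2)⁻¹ := by positivity
  simp only [ENNReal.toReal_ofReal this, Complex.real_smul]

/-- The traces of `B` on the lines `Im z = -δ_n` are bounded in `L²(dt/(1+t²))`, and `h` is a weak
limit of them. The Poisson kernel divided by the weight is bounded, hence an admissible test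
function, and Poisson's formula passes to the limit. -/
lemma exists_boundary_function {B : ℂ → ℂ} (hB : DifferentiableOn ℂ B {z | z.im < 0})
    (hb : ∀ z : ℂ, z.im < 0 → ‖B z‖ ≤ 1) :
    ∃ h : ℝ → ℂ, (Integrable fun t : ℝ => ((1 + t ^ 2)⁻¹ : ℝ) * h t) ∧
      ∀ (x y : ℝ), 0 < y →
        ∫ t : ℝ, (poisson y (x - t) : ℂ) * h t = Real.pi * B (x - y * Complex.I) := by
  let δ : ℕ → ℝ := fun n => 1 / ((n : ℝ) + 1)
  have hδ : ∀ n, 0 < δ n := fun n => Nat.one_div_pos_of_nat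
  have hδ0 : Tendsto δ atTop (𝓝 0) := tendsto_one_div_add_atTop_nhds_zero_nat
  have hc : ∀ n, Continuous fun t : ℝ => B (t - δ n * Complex.I) := fun n =>
    hB.continuousOn.comp_continuous (by fun_prop) fun t => lower_shift_mem (hδ n)
  have hmem : ∀ n, MemLp (fun t : ℝ => B (t - δ n * Complex.I)) 2 cauchyWeight := fun n =>
    MemLp.of_bound (hc n).aestronglyMeasurable 1
      (Eventually.of_forall fun t => hb _ (lower_shift_mem (hδ n)))
  let u : ℕ → Lp ℂ 2 cauchyWeight := fun n => (hmem n).toLp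
  have hu : ∃ c : ℝ, ∀ n, ‖u n‖ ≤ c := by
    refine ⟨_, fun n => Lp.norm_le_of_ae_bound zero_le_one ?_⟩
    filter_upwards [(hmem n).coeFn_toLp] with t ht
    rw [ht]
    exact hb _ (lower_shift_mem (hδ n))
  obtain ⟨c, hu⟩ := hu
  obtain ⟨h, hh⟩ := exists_weak_limit hu (hyperfilter ℕ)
  have hhi : Integrable h cauchyWeight := (Lp.memLp h).integrable (by norm_num)
  refine ⟨h, integrable_cauchyWeight_iff.1 hhi, fun x y hy => ?_⟩
  have hKc : Continuous fun t : ℝ => ((poisson y (x - t) * (1 + t ^ 2) : ℝ) : ℂ) := by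
    have : Continuous fun t => poisson y (x - t) := (continuous_poisson hy).comp (by fun_prop)
    fun_prop
  obtain ⟨K, hK⟩ := exists_poisson_bound x hy
  have hKm : MemLp (fun t : ℝ => ((poisson y (x - t) * (1 + t ^ 2) : ℝ) : ℂ)) 2 cauchyWeight :=
    MemLp.of_bound hKc.aestronglyMeasurable K (Eventually.of_forall hK)
  have hinner : ∀ (v : Lp ℂ 2 cauchyWeight) (v' : ℝ → ℂ), v =ᵐ[cauchyWeight] v' →
      inner ℂ hKm.toLp v = ∫ t : ℝ, (poisson y (x - t) : ℂ) * v' t := by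
    intro v v' hv
    rw [L2.inner_def]
    have : ∫ t, inner ℂ ((hKm.toLp : Lp ℂ 2 cauchyWeight) t) (v t) ∂cauchyWeight
        = ∫ t : ℝ, ((poisson y (x - t) * (1 + t ^ 2) : ℝ) : ℂ) * v' t ∂cauchyWeight := by
      refine integral_congr_ae ?_
      filter_upwards [hKm.coeFn_toLp, hv] with t h1 h2
      rw [h1, h2, RCLike.inner_apply, Complex.conj_ofReal, mul_comm]
    rw [this, integral_cauchyWeight]
    refine integral_congr_ae (Eventually.of_forall fun t => ?_)
    have h1 : (1 + t ^ 2 : ℝ) ≠ 0 := by positivity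
    have := Complex.ofReal_ne_zero.2 h1
    simp only [Complex.ofReal_mul, Complex.ofReal_inv]
    field_simp
  have h1 := hh hKm.toLp
  rw [hinner h h (ae_eq_refl _)] at h1
  have h2 : ∀ n, inner ℂ hKm.toLp (u n) = Real.pi * B (x - (y + δ n : ℝ) * Complex.I) := by
    intro n
    rw [hinner _ _ (hmem n).coeFn_toLp]
    rw [poisson_formula (F := fun z => B (z - δ n * Complex.I)) (hδ n) (C := 1) ?_ ?_ x hy]
    · congr 2; push_cast; ring
    · refine hB.comp (by fun_prop) fun z hz => ?_
      have hz : z.im < δ n := hz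
      simpa using hz
    · intro z hz
      refine hb _ ?_
      have := hδ n
      simp; linarith
  simp_rw [h2] at h1
  refine tendsto_nhds_unique h1 ?_
  refine Tendsto.mono_left ?_ (hyperfilter_le_cofinite.trans Nat.cofinite_eq_atTop.le)
  refine Tendsto.const_mul _ ?_
  have hcB : ContinuousAt B (x - y * Complex.I) :=
    (hB.differentiableAt ((isOpen_im_lt 0).mem_nhds (lower_shift_mem hy))).continuousAt
  refine hcB.tendsto.comp ?_
  have h3 : Tendsto (fun n => (x : ℂ) - ((y + δ n : ℝ) : ℂ) * Complex.I) atTop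
      (𝓝 (x - ((y + 0 : ℝ) : ℂ) * Complex.I)) :=
    ((Complex.continuous_ofReal.tendsto _).comp (hδ0.const_add y)).mul_const _ |>.const_sub _
  simpa using h3

/-- **Fatou's theorem**: a bounded holomorphic function in the lower half-plane has vertical
limits at almost every boundary point. -/
lemma ae_exists_boundary_limit {B : ℂ → ℂ} (hB : DifferentiableOn ℂ B {z | z.im < 0})
    (hb : ∀ z : ℂ, z.im < 0 → ‖B z‖ ≤ 1) :
    ∀ᵐ x : ℝ, ∃ l, Tendsto (fun y : ℝ => B (x - y * Complex.I)) (𝓝[>] 0) (𝓝 l) := by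
  obtain ⟨h, hi, hp⟩ := exists_boundary_function hB hb
  filter_upwards [ae_isLebesguePoint (locallyIntegrable_of_weighted hi)] with x hx
  refine ⟨h x, ?_⟩
  have h1 := (hx.tendsto_poisson hi).const_mul ((Real.pi : ℂ)⁻¹)
  have hpi : (Real.pi : ℂ) ≠ 0 := Complex.ofReal_ne_zero.2 Real.pi_ne_zero
  rw [← mul_assoc, inv_mul_cancel₀ hpi, one_mul] at h1
  refine h1.congr' ?_
  filter_upwards [self_mem_nhdsWithin] with y hy
  rw [hp x y hy, ← mul_assoc, inv_mul_cancel₀ hpi, one_mul]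

/-! ### Boundary limits of maps from the lower to the upper half-plane -/

section Nevanlinna

variable {S : ℂ → ℂ}

lemma le_norm_add_mul_I {s : ℂ} (hs : 0 ≤ s.im) (k : ℝ) : k ≤ ‖s + k * Complex.I‖ := by
  refine le_trans ?_ ((le_abs_self _).trans (Complex.abs_im_le_norm _))
  simpa using hs

lemma add_mul_I_ne_zero {s : ℂ} (hs : 0 ≤ s.im) {k : ℝ} (hk : 0 < k) : s + k * Complex.I ≠ 0 :=
  norm_pos_iff.1 (hk.trans_le (le_norm_add_mul_I hs k))

lemma norm_div_add_mul_I_le_one {s : ℂ} (hs : 0 ≤ s.im) {k : ℝ} (hk : 0 < k) :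
    ‖(k : ℂ) / (s + k * Complex.I)‖ ≤ 1 := by
  rw [norm_div, Complex.norm_real, Real.norm_of_nonneg hk.le]
  exact div_le_one_of_le₀ (le_norm_add_mul_I hs k) (norm_nonneg _)

lemma differentiableOn_div_add_mul_I (hS : DifferentiableOn ℂ S {z | z.im < 0})
    (him : ∀ z : ℂ, z.im < 0 → 0 ≤ (S z).im) {k : ℝ} (hk : 0 < k) :
    DifferentiableOn ℂ (fun z => (k : ℂ) / (S z + k * Complex.I)) {z | z.im < 0} :=
  (differentiableOn_const _).div (hS.add_const _) fun z hz => add_mul_I_ne_zero (him z hz) hk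

lemma measure_real_cauchyWeight_univ : cauchyWeight.real Set.univ = Real.pi := by
  have h := integral_cauchyWeight fun _ => 1
  simp only [mul_one, integral_const, integral_complex_ofReal, integral_univ_inv_one_add_sq] at h
  have h2 : ((cauchyWeight.real Set.univ : ℝ) : ℂ) = (Real.pi : ℝ) := by simpa using h
  exact_mod_cast h2

lemma volume_eq_zero_of_cauchyWeight {s : Set ℝ} (h : cauchyWeight s = 0) : volume s = 0 := by
  refine withDensity_absolutelyContinuous' (by fun_prop) ?_ h
  exact Eventually.of_forall fun t => by
    rw [ne_eq, ENNReal.ofReal_eq_zero, not_le]; positivity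

/-- A holomorphic function from the lower to the upper half-plane has an infinite vertical limit
only on a null set. -/
lemma volume_setOf_tendsto_inv_zero (hS : DifferentiableOn ℂ S {z | z.im < 0})
    (him : ∀ z : ℂ, z.im < 0 → 0 ≤ (S z).im) {δ : ℕ → ℝ} (hδ : ∀ n, 0 < δ n)
    (hδ0 : Tendsto δ atTop (𝓝 0)) :
    volume {x : ℝ | Tendsto (fun n => ((1 : ℝ) : ℂ) / (S (x - δ n * Complex.I)
      + (1 : ℝ) * Complex.I)) atTop (𝓝 0)} = 0 := by
  -- All `B k` tend to `0` along `δ_n` on the exceptional set `E`, but `B k (-i) → 1` as `k → ∞`.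
  -- Poisson's formula at `-i` bounds `π ‖B k (-i)‖` by the Cauchy weight of `Eᶜ`, which must
  -- therefore be the full mass `π`.
  set B : ℝ → ℂ → ℂ := fun k z => (k : ℂ) / (S z + k * Complex.I) with hBdef
  have hBd : ∀ k > 0, DifferentiableOn ℂ (B k) {z | z.im < 0} := fun k hk =>
    differentiableOn_div_add_mul_I hS him hk
  have hBb : ∀ k > 0, ∀ z : ℂ, z.im < 0 → ‖B k z‖ ≤ 1 := fun k hk z hz =>
    norm_div_add_mul_I_le_one (him z hz) hk
  have hBc : ∀ k > 0, ∀ n, Continuous fun t : ℝ => B k (t - δ n * Complex.I) := fun k hk n =>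
    (hBd k hk).continuousOn.comp_continuous (by fun_prop) fun t => lower_shift_mem (hδ n)
  set E : Set ℝ := {x : ℝ | Tendsto (fun n => B 1 (x - δ n * Complex.I)) atTop (𝓝 0)} with hE
  have hEm : MeasurableSet E :=
    measurableSet_tendsto _ fun n => (hBc 1 one_pos n).measurable
  have hEk : ∀ k > 0, ∀ x ∈ E, Tendsto (fun n => B k (x - δ n * Complex.I)) atTop (𝓝 0) := by
    intro k hk x hx
    have hx : Tendsto (fun n => B 1 (x - δ n * Complex.I)) atTop (𝓝 0) := hx
    -- `B k` is a Möbius function of `B 1` fixing `0`.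
    have h1 : Tendsto (fun n => k * B 1 (x - δ n * Complex.I)
        / (1 + (k - 1) * Complex.I * B 1 (x - δ n * Complex.I))) atTop
        (𝓝 (k * 0 / (1 + (k - 1) * Complex.I * 0))) := by
      refine Tendsto.div (hx.const_mul _) ((hx.const_mul _).const_add _) (by simp)
    rw [mul_zero, zero_div] at h1
    refine h1.congr fun n => ?_
    have hs := him _ (lower_shift_mem (t := x) (hδ n))
    have h2 := add_mul_I_ne_zero hs hk
    have h3 := add_mul_I_ne_zero hs one_pos
    rw [hBdef]
    simp only
    rw [eq_div_iff h2, div_mul_eq_mul_div, div_eq_iff]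
    · field_simp; push_cast; ring
    · have : 1 + ((k : ℂ) - 1) * Complex.I * (((1 : ℝ) : ℂ) / (S (x - δ n * Complex.I)
          + (1 : ℝ) * Complex.I))
          = (S (x - δ n * Complex.I) + k * Complex.I) / (S (x - δ n * Complex.I)
          + (1 : ℝ) * Complex.I) := by
        rw [eq_div_iff h3, add_mul, mul_assoc, div_mul_cancel₀ _ h3]
        push_cast; ring
      rw [this]
      exact div_ne_zero h2 h3
  have hbound : ∀ k > 0, Real.pi * ‖B k (-Complex.I)‖ ≤ cauchyWeight.real Eᶜ := by
    intro k hk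
    have hle : ∀ n, Real.pi * ‖B k ((0 : ℝ) - (1 + δ n : ℝ) * Complex.I)‖
        ≤ (∫ t in E, ‖B k (t - δ n * Complex.I)‖ ∂cauchyWeight) + cauchyWeight.real Eᶜ := by
      intro n
      have hint : Integrable (fun t : ℝ => B k (t - δ n * Complex.I)) cauchyWeight :=
        Integrable.of_bound (hBc k hk n).aestronglyMeasurable 1
          (Eventually.of_forall fun t => hBb k hk _ (lower_shift_mem (hδ n)))
      -- At height `1` above the origin the Poisson kernel is the Cauchy weight itself.
      have h1 := poisson_formula (F := fun z => B k (z - δ n * Complex.I)) (hδ n) (C := 1)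
        ?_ ?_ 0 one_pos
      · have h2 : ∫ t : ℝ, B k (t - δ n * Complex.I) ∂cauchyWeight
            = Real.pi * B k ((0 : ℝ) - (1 + δ n : ℝ) * Complex.I) := by
          rw [integral_cauchyWeight]
          convert h1 using 3 with t
          · simp [poisson, add_comm]
          · push_cast; ring
        have h3 : Real.pi * ‖B k ((0 : ℝ) - (1 + δ n : ℝ) * Complex.I)‖
            = ‖∫ t : ℝ, B k (t - δ n * Complex.I) ∂cauchyWeight‖ := by
          rw [h2, norm_mul, Complex.norm_real, Real.norm_of_nonneg Real.pi_pos.le]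
        rw [h3]
        refine (norm_integral_le_integral_norm _).trans ?_
        rw [← integral_add_compl hEm hint.norm]
        gcongr
        refine (setIntegral_mono_on hint.norm.integrableOn (integrableOn_const (C := (1 : ℝ)))
          hEm.compl fun t _ => hBb k hk _ (lower_shift_mem (hδ n))).trans ?_
        simp
      · refine (hBd k hk).comp (by fun_prop) fun z hz => ?_
        have hz : z.im < δ n := hz
        simpa using hz
      · intro z hz
        refine hBb k hk _ ?_
        have := hδ n
        simp; linarith
    have hlim1 : Tendsto (fun n => ∫ t in E, ‖B k (t - δ n * Complex.I)‖ ∂cauchyWeight) atTop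
        (𝓝 (∫ t in E, (0 : ℝ) ∂cauchyWeight)) := by
      refine tendsto_integral_of_dominated_convergence (fun _ => (1 : ℝ))
        (fun n => (hBc k hk n).norm.aestronglyMeasurable) (integrable_const _)
        (fun n => Eventually.of_forall fun t => ?_) ?_
      · rw [norm_norm]
        exact hBb k hk _ (lower_shift_mem (hδ n))
      · filter_upwards [ae_restrict_mem hEm] with t ht
        simpa using (hEk k hk t ht).norm
    have hlim2 : Tendsto (fun n => Real.pi * ‖B k ((0 : ℝ) - (1 + δ n : ℝ) * Complex.I)‖) atTop
        (𝓝 (Real.pi * ‖B k (-Complex.I)‖)) := by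
      refine (Tendsto.norm ?_).const_mul _
      have hcB : ContinuousAt (B k) (-Complex.I) :=
        ((hBd k hk).differentiableAt ((isOpen_im_lt 0).mem_nhds (by simp))).continuousAt
      refine hcB.tendsto.comp ?_
      have h3 : Tendsto (fun n => ((0 : ℝ) : ℂ) - ((1 + δ n : ℝ) : ℂ) * Complex.I) atTop
          (𝓝 (((0 : ℝ) : ℂ) - ((1 + 0 : ℝ) : ℂ) * Complex.I)) :=
        ((Complex.continuous_ofReal.tendsto _).comp (hδ0.const_add 1)).mul_const _ |>.const_sub _
      simpa using h3
    have := le_of_tendsto_of_tendsto' hlim2 (hlim1.add_const _) hle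
    simpa using this
  have hk : Tendsto (fun k : ℕ => Real.pi * ‖B ((k : ℝ) + 1) (-Complex.I)‖) atTop
      (𝓝 (Real.pi * 1)) := by
    refine Tendsto.const_mul _ ?_
    have h1 : Tendsto (fun k : ℕ => (1 : ℂ) / (S (-Complex.I) * ((1 / ((k : ℝ) + 1) : ℝ) : ℂ)
        + Complex.I)) atTop (𝓝 ((1 : ℂ) / (S (-Complex.I) * ((0 : ℝ) : ℂ) + Complex.I))) := by
      refine Tendsto.div tendsto_const_nhds (Tendsto.add_const _ (Tendsto.const_mul _ ?_))
        (by simp)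
      exact (Complex.continuous_ofReal.tendsto _).comp tendsto_one_div_add_atTop_nhds_zero_nat
    have h2 := h1.norm
    simp only [Complex.ofReal_zero, mul_zero, zero_add, one_div, norm_inv, Complex.norm_I,
      inv_one] at h2
    refine h2.congr fun k => ?_
    rw [hBdef, ← norm_inv]
    congr 1
    simp only [Complex.ofReal_inv]
    have : (((k : ℝ) + 1 : ℝ) : ℂ) ≠ 0 := Complex.ofReal_ne_zero.2 (by positivity)
    rw [inv_eq_one_div, div_eq_div_iff_comm]
    field_simp
  have hfin : Real.pi ≤ cauchyWeight.real Eᶜ := by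
    rw [mul_one] at hk
    exact le_of_tendsto' hk fun k => hbound _ (by positivity)
  refine volume_eq_zero_of_cauchyWeight (s := E) ?_
  have h1 := measureReal_add_measureReal_compl (μ := cauchyWeight) hEm
  rw [measure_real_cauchyWeight_univ] at h1
  have h2 : cauchyWeight.real E = 0 := le_antisymm (by linarith) measureReal_nonneg
  exact (measureReal_eq_zero_iff).1 h2

/-- A holomorphic function from the lower to the upper half-plane has finite vertical limits at
almost every boundary point. -/
lemma ae_exists_boundary_limit_of_im_nonneg (hS : DifferentiableOn ℂ S {z | z.im < 0})
    (him : ∀ z : ℂ, z.im < 0 → 0 ≤ (S z).im) :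
    ∀ᵐ x : ℝ, ∃ l, Tendsto (fun y : ℝ => S (x - y * Complex.I)) (𝓝[>] 0) (𝓝 l) := by
  have hδ : ∀ n : ℕ, 0 < 1 / ((n : ℝ) + 1) := fun n => Nat.one_div_pos_of_nat
  have hδ0 : Tendsto (fun n : ℕ => 1 / ((n : ℝ) + 1)) atTop (𝓝 0) :=
    tendsto_one_div_add_atTop_nhds_zero_nat
  filter_upwards [ae_exists_boundary_limit (differentiableOn_div_add_mul_I hS him one_pos)
    (fun z hz => norm_div_add_mul_I_le_one (him z hz) one_pos),
    compl_mem_ae_iff.2 (volume_setOf_tendsto_inv_zero hS him hδ hδ0)] with x hx hxE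
  obtain ⟨l, hl⟩ := hx
  have hl0 : l ≠ 0 := by
    rintro rfl
    refine hxE (hl.comp (tendsto_nhdsWithin_iff.2 ⟨hδ0, Eventually.of_forall fun n => hδ n⟩))
  -- `S` is recovered from `1 / (S + i)`, whose limit `l` is nonzero off the null set.
  refine ⟨l⁻¹ - Complex.I, ((hl.inv₀ hl0).sub_const _).congr' ?_⟩
  filter_upwards [self_mem_nhdsWithin] with y hy
  simp

end Nevanlinna

/-! ### Stieltjes transforms and the reducer -/

section Stieltjes

lemma abs_im_le_norm_sub_ofReal (z : ℂ) (t : ℝ) : |z.im| ≤ ‖z - t‖ := by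
  simpa using Complex.abs_im_le_norm (z - t)

lemma sub_ofReal_ne_zero {z : ℂ} (hz : z.im ≠ 0) (t : ℝ) : z - t ≠ 0 :=
  norm_pos_iff.1 ((abs_pos.2 hz).trans_le (abs_im_le_norm_sub_ofReal z t))

lemma integrable_div_sub {f : ℝ → ℂ} (hf : Integrable f) {z : ℂ} (hz : z.im ≠ 0) :
    Integrable fun t : ℝ => f t / (z - t) := by
  have hc : Continuous fun t : ℝ => (z - t)⁻¹ :=
    Continuous.inv₀ (by fun_prop) (sub_ofReal_ne_zero hz)
  refine (hf.mul_bdd (c := |z.im|⁻¹) hc.aestronglyMeasurable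
    (Eventually.of_forall fun t => ?_)).congr
    (Eventually.of_forall fun t => (div_eq_mul_inv _ _).symm)
  rw [norm_inv]
  exact inv_anti₀ (abs_pos.2 hz) (abs_im_le_norm_sub_ofReal z t)

variable {w : ℝ → ℝ}

lemma stieltjes_conj (w : ℝ → ℝ) (z : ℂ) :
    stieltjes w (starRingEnd ℂ z) = starRingEnd ℂ (stieltjes w z) := by
  rw [stieltjes, stieltjes, ← integral_conj]
  refine integral_congr_ae (Eventually.of_forall fun t => ?_)
  simp

lemma differentiableOn_stieltjes (hw : Integrable w) :
    DifferentiableOn ℂ (stieltjes w) {z | z.im < 0} := by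
  intro z0 hz0
  have hz0 : z0.im < 0 := hz0
  refine DifferentiableAt.differentiableWithinAt ?_
  set r : ℝ := -z0.im / 2 with hr
  have hr0 : 0 < r := by rw [hr]; linarith
  have hball : ∀ z ∈ Metric.ball z0 r, r < -z.im := by
    intro z hz
    have h1 : |(z - z0).im| < r := (Complex.abs_im_le_norm _).trans_lt (by simpa [dist_eq_norm] using hz)
    rw [Complex.sub_im] at h1
    have := (abs_lt.1 h1).2
    linarith
  have hne : ∀ z ∈ Metric.ball z0 r, ∀ t : ℝ, r ≤ ‖z - t‖ := fun z hz t =>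
    ((hball z hz).le.trans (neg_le_abs _)).trans (abs_im_le_norm_sub_ofReal z t)
  have hne0 : ∀ z ∈ Metric.ball z0 r, ∀ t : ℝ, z - t ≠ 0 := fun z hz t =>
    norm_pos_iff.1 (hr0.trans_le (hne z hz t))
  have hm : AEStronglyMeasurable (fun t => (w t : ℂ)) := hw.ofReal.aestronglyMeasurable
  have hcinv : ∀ z ∈ Metric.ball z0 r, Continuous fun t : ℝ => (z - t)⁻¹ := fun z hz =>
    Continuous.inv₀ (by fun_prop) (hne0 z hz)
  refine (hasDerivAt_integral_of_dominated_loc_of_deriv_le (μ := volume)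
    (F := fun z (t : ℝ) => (w t : ℂ) / (z - t)) (F' := fun z (t : ℝ) => -(w t : ℂ) / (z - t) ^ 2)
    (bound := fun t => ‖w t‖ * (r ^ 2)⁻¹)
    (Metric.ball_mem_nhds z0 hr0) ?_ ?_ ?_ ?_ ?_ ?_).2.differentiableAt
  · filter_upwards [Metric.ball_mem_nhds z0 hr0] with z hz
    simp_rw [div_eq_mul_inv]
    exact hm.mul (hcinv z hz).aestronglyMeasurable
  · exact integrable_div_sub hw.ofReal (by linarith)
  · simp_rw [div_eq_mul_inv, ← inv_pow]
    exact hm.neg.mul ((hcinv z0 (Metric.mem_ball_self hr0)).pow 2).aestronglyMeasurable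
  · refine Eventually.of_forall fun t z hz => ?_
    rw [norm_div, norm_neg, norm_pow, Complex.norm_real, div_eq_mul_inv]
    gcongr
    exact hne z hz t
  · exact hw.norm.mul_const _
  · refine Eventually.of_forall fun t z hz => ?_
    have h := ((hasDerivAt_id z).sub_const (t : ℂ)).inv (hne0 z hz t)
    have h2 := h.const_mul (w t : ℂ)
    convert! h2 using 1
    simp; ring

/-- The link to the boundary theory: below the real axis the imaginary part of a Stieltjes transform
is the Poisson integral of the density. -/
lemma im_div_sub (a x y t : ℝ) :
    ((a : ℂ) / ((x : ℂ) - y * Complex.I - t)).im = poisson y (x - t) * a := by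
  rw [Complex.div_im, Complex.normSq_apply]
  simp [poisson]
  ring

lemma im_stieltjes (hw : Integrable w) (x : ℝ) {y : ℝ} (hy : 0 < y) :
    (stieltjes w (x - y * Complex.I)).im = ∫ t, poisson y (x - t) * w t := by
  have hi : Integrable fun t : ℝ => (w t : ℂ) / ((x : ℂ) - y * Complex.I - t) :=
    integrable_div_sub hw.ofReal (by simpa using hy.ne')
  have h : ∫ t : ℝ, ((w t : ℂ) / ((x : ℂ) - y * Complex.I - t)).im
      = (∫ t : ℝ, (w t : ℂ) / ((x : ℂ) - y * Complex.I - t)).im := integral_im hi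
  rw [stieltjes, ← h]
  exact integral_congr_ae (Eventually.of_forall fun t => im_div_sub _ _ _ _)

lemma im_stieltjes_pos (hw : Integrable w) (hw0 : ∀ t, 0 ≤ w t) (hpos : 0 < ∫ t, w t)
    {z : ℂ} (hz : z.im < 0) : 0 < (stieltjes w z).im := by
  have hy : 0 < -z.im := by linarith
  have hzz : z = (z.re : ℂ) - (-z.im : ℝ) * Complex.I := by apply Complex.ext <;> simp
  rw [hzz, im_stieltjes hw _ hy]
  have hc : Continuous fun t => poisson (-z.im) (z.re - t) :=
    (continuous_poisson hy).comp (by fun_prop)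
  rw [integral_pos_iff_support_of_nonneg (fun t => mul_nonneg (poisson_nonneg hy _) (hw0 t))]
  · rw [integral_pos_iff_support_of_nonneg hw0 hw] at hpos
    convert hpos using 2
    ext t
    have : poisson (-z.im) (z.re - t) ≠ 0 := by
      have : 0 < poisson (-z.im) (z.re - t) := by unfold poisson; positivity
      exact this.ne'
    simp [this]
  · refine hw.bdd_mul (c := (-z.im)⁻¹) hc.aestronglyMeasurable (Eventually.of_forall fun t => ?_)
    rw [Real.norm_of_nonneg (poisson_nonneg hy _), poisson, div_le_iff₀ (by positivity)]
    have : (-z.im)⁻¹ * (-z.im) ^ 2 = -z.im := by field_simp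
    nlinarith [mul_nonneg (inv_nonneg.2 hy.le) (sq_nonneg (z.re - t))]

lemma stieltjes_ne_zero (hw : Integrable w) (hw0 : ∀ t, 0 ≤ w t) (hpos : 0 < ∫ t, w t)
    {z : ℂ} (hz : z.im ≠ 0) : stieltjes w z ≠ 0 := by
  rcases hz.lt_or_gt with h | h
  · intro h0
    have := im_stieltjes_pos hw hw0 hpos h
    rw [h0] at this
    exact lt_irrefl _ this
  · intro h0
    have := im_stieltjes_pos hw hw0 hpos (z := starRingEnd ℂ z) (by simpa using h)
    rw [stieltjes_conj, h0] at this
    simp at this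

lemma ae_exists_stieltjes_limit (hw : Integrable w) (hw0 : ∀ t, 0 ≤ w t) (hpos : 0 < ∫ t, w t) :
    ∀ᵐ x : ℝ, ∃ l, Tendsto (fun y : ℝ => stieltjes w (x - y * Complex.I)) (𝓝[>] 0) (𝓝 l) :=
  ae_exists_boundary_limit_of_im_nonneg (differentiableOn_stieltjes hw)
    fun _ hz => (im_stieltjes_pos hw hw0 hpos hz).le

lemma integrable_weighted (hw : Integrable w) :
    Integrable fun t : ℝ => ((1 + t ^ 2)⁻¹ : ℝ) * (w t : ℂ) := by
  have hc : Continuous fun t : ℝ => (((1 + t ^ 2)⁻¹ : ℝ) : ℂ) := by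
    refine Complex.continuous_ofReal.comp (Continuous.inv₀ (by fun_prop) fun t => by positivity)
  refine hw.ofReal.bdd_mul (c := 1) hc.aestronglyMeasurable (Eventually.of_forall fun t => ?_)
  rw [Complex.norm_real, Real.norm_of_nonneg (by positivity)]
  exact inv_le_one_of_one_le₀ (by nlinarith [sq_nonneg t])

lemma IsLebesguePoint.tendsto_im_stieltjes (hw : Integrable w) {x : ℝ}
    (hx : IsLebesguePoint (fun t => (w t : ℂ)) x) :
    Tendsto (fun y : ℝ => (stieltjes w (x - y * Complex.I)).im) (𝓝[>] 0)
      (𝓝 (Real.pi * w x)) := by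
  have h := hx.tendsto_poisson (integrable_weighted hw)
  have h2 := (Complex.continuous_re.tendsto _).comp h
  simp only [← Complex.ofReal_mul, Complex.ofReal_re] at h2
  refine h2.congr' ?_
  filter_upwards [self_mem_nhdsWithin] with y hy
  rw [im_stieltjes hw x hy, Function.comp_apply, integral_complex_ofReal, Complex.ofReal_re]

lemma ae_tendsto_im_stieltjes (hw : Integrable w) :
    ∀ᵐ x : ℝ, Tendsto (fun y : ℝ => (stieltjes w (x - y * Complex.I)).im) (𝓝[>] 0)
      (𝓝 (Real.pi * w x)) := by
  filter_upwards [ae_isLebesguePoint hw.ofReal.locallyIntegrable] with x hx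
  exact hx.tendsto_im_stieltjes hw

/-- The two values are conjugate. So the reducer governs the real part of the boundary limit, and
the density its imaginary part. -/
lemma reducerApprox_eq (w : ℝ → ℝ) (x y : ℝ) :
    reducerApprox w x y = ((2 * (stieltjes w (x - y * Complex.I)).re : ℝ) : ℂ) := by
  have : (x : ℂ) + y * Complex.I = starRingEnd ℂ (x - y * Complex.I) := by simp
  rw [reducerApprox, this, stieltjes_conj, Complex.add_conj]

lemma hasReducer_of_tendsto {x : ℝ} {s : ℂ}
    (h : Tendsto (fun y : ℝ => stieltjes w (x - y * Complex.I)) (𝓝[>] 0) (𝓝 s)) :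
    HasReducer w x ∧ reducer w x / 2 = s.re := by
  have h1 : Tendsto (reducerApprox w x) (𝓝[>] 0) (𝓝 ((2 * s.re : ℝ) : ℂ)) := by
    have h2 : Tendsto (fun y : ℝ => 2 * (stieltjes w (x - y * Complex.I)).re) (𝓝[>] 0)
        (𝓝 (2 * s.re)) := ((Complex.continuous_re.tendsto _).comp h).const_mul 2
    refine ((Complex.continuous_ofReal.tendsto _).comp h2).congr fun y => ?_
    rw [reducerApprox_eq]; rfl
  have h3 : reducer w x = 2 * s.re := by rw [reducer, h1.limUnder_eq, Complex.ofReal_re]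
  refine ⟨?_, by rw [h3]; ring⟩
  rw [HasReducer, h3]
  exact h1

lemma tendsto_stieltjes_of_hasReducer {x m : ℝ} (h : HasReducer w x)
    (him : Tendsto (fun y : ℝ => (stieltjes w (x - y * Complex.I)).im) (𝓝[>] 0) (𝓝 m)) :
    Tendsto (fun y : ℝ => stieltjes w (x - y * Complex.I)) (𝓝[>] 0)
      (𝓝 ((reducer w x / 2 : ℝ) + m * Complex.I)) := by
  have h1 := (Complex.continuous_re.tendsto _).comp h
  simp only [Function.comp_def, reducerApprox_eq, Complex.ofReal_re] at h1
  have h2 : Tendsto (fun y : ℝ => (stieltjes w (x - y * Complex.I)).re) (𝓝[>] 0)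
      (𝓝 (reducer w x / 2)) := (h1.div_const 2).congr fun y => by ring
  have h3 := ((Complex.continuous_ofReal.tendsto _).comp h2).add
    (((Complex.continuous_ofReal.tendsto _).comp him).mul_const Complex.I)
  exact h3.congr fun y => Complex.re_add_im _

end Stieltjes

/-! ### Moments from the decay at infinity -/

section Moments

variable {w : ℝ → ℝ}

lemma integrable_complex_ofReal (hw : Integrable w) : Integrable fun t => (w t : ℂ) := hw.ofReal

lemma integrable_eval_mul (hw : ∀ k : ℕ, Integrable fun t => t ^ k * w t) (p : ℝ[X]) :
    Integrable fun t => p.eval t * w t := by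
  simp_rw [eval_eq_sum_range, Finset.sum_mul, mul_assoc]
  exact integrable_finsetSum _ fun k _ => (hw k).const_mul _

lemma integrable_of_moments (hw : ∀ k : ℕ, Integrable fun t => t ^ k * w t) : Integrable w := by
  simpa using hw 0

lemma integrable_pow_mul_eval_mul (hw : ∀ k : ℕ, Integrable fun t => t ^ k * w t) (p : ℝ[X])
    (k : ℕ) : Integrable fun t => t ^ k * (p.eval t * w t) :=
  (integrable_eval_mul hw (X ^ k * p)).congr
    (Eventually.of_forall fun t => by simp [mul_assoc])

/-- Dominated convergence, with `|iy / (iy - t)| ≤ 1`. -/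
lemma tendsto_mul_stieltjes (hw : Integrable w) :
    Tendsto (fun y : ℝ => ((y : ℂ) * Complex.I) * stieltjes w (y * Complex.I)) atTop
      (𝓝 ((∫ t, w t : ℝ) : ℂ)) := by
  rw [← integral_complex_ofReal]
  simp_rw [stieltjes, ← integral_const_mul]
  have him : ∀ y : ℝ, ((y : ℂ) * Complex.I).im = y := fun y => by simp
  refine tendsto_integral_filter_of_dominated_convergence (fun t => ‖w t‖) ?_ ?_ hw.norm ?_
  · filter_upwards [eventually_gt_atTop 0] with y hy
    exact ((integrable_div_sub hw.ofReal (by rw [him]; exact hy.ne')).const_mul _).1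
  · filter_upwards [eventually_gt_atTop 0] with y hy
    refine Eventually.of_forall fun t => ?_
    have h1 := abs_im_le_norm_sub_ofReal (y * Complex.I) t
    rw [him, abs_of_pos hy] at h1
    rw [norm_mul, norm_mul, norm_div, Complex.norm_I, Complex.norm_real, Complex.norm_real,
      mul_one, ← mul_div_assoc, div_le_iff₀ (hy.trans_le h1), Real.norm_of_nonneg hy.le, mul_comm]
    gcongr
  · refine Eventually.of_forall fun t => ?_
    have h1 : Tendsto (fun y : ℝ => (w t : ℂ) / (1 - t * (((y⁻¹ : ℝ) : ℂ) * -Complex.I))) atTop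
        (𝓝 ((w t : ℂ) / (1 - t * (((0 : ℝ) : ℂ) * -Complex.I)))) := by
      refine Tendsto.div tendsto_const_nhds (Tendsto.const_sub _ (Tendsto.const_mul _
        (Tendsto.mul_const _ ?_))) (by simp)
      exact (Complex.continuous_ofReal.tendsto _).comp tendsto_inv_atTop_zero
    simp only [Complex.ofReal_zero, zero_mul, mul_zero, sub_zero, div_one] at h1
    refine h1.congr' ?_
    filter_upwards [eventually_gt_atTop 0] with y hy
    have h2 : (y : ℂ) * Complex.I - t ≠ 0 := sub_ofReal_ne_zero (by rw [him]; exact hy.ne') t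
    have h3 : (y : ℂ) * Complex.I ≠ 0 := by
      simp [hy.ne']
    have h4 : 1 - t * (((y⁻¹ : ℝ) : ℂ) * -Complex.I)
        = ((y : ℂ) * Complex.I - t) / ((y : ℂ) * Complex.I) := by
      rw [eq_div_iff h3]
      have : (y : ℂ) ≠ 0 := Complex.ofReal_ne_zero.2 hy.ne'
      push_cast
      field_simp
      linear_combination (t : ℂ) * Complex.I_sq
    rw [h4]
    field_simp

lemma stieltjes_id_mul (hw : Integrable w) {z : ℂ} (hz : z.im ≠ 0) :
    stieltjes (fun t => t * w t) z = z * stieltjes w z - (∫ t, w t : ℝ) := by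
  rw [stieltjes, stieltjes, ← integral_complex_ofReal, ← integral_const_mul,
    ← integral_sub ((integrable_div_sub (integrable_complex_ofReal hw) hz).const_mul z) (integrable_complex_ofReal hw)]
  refine integral_congr_ae (Eventually.of_forall fun t => ?_)
  have := sub_ofReal_ne_zero hz t
  simp only [Complex.ofReal_mul]
  field_simp
  ring

/-- Formally `S(z) = ∑ m_k z^(-k-1)`, so the decay rate shows the first nonzero moment. Decay faster
than `1/z` forces mass zero; then `t w` has transform `z S(z)`, which decays one order less, and
induction applies. -/
lemma moments_of_tendsto_pow_mul_stieltjes {n : ℕ} {L : ℝ} :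
    ∀ {w : ℝ → ℝ}, (∀ k : ℕ, Integrable fun t => t ^ k * w t) →
    Tendsto (fun y : ℝ => ((y : ℂ) * Complex.I) ^ (n + 1) * stieltjes w (y * Complex.I)) atTop
      (𝓝 (L : ℂ)) →
    (∀ k < n, ∫ t, t ^ k * w t = 0) ∧ ∫ t, t ^ n * w t = L := by
  induction n with
  | zero =>
    intro w hw h
    refine ⟨fun k hk => absurd hk (Nat.not_lt_zero k), ?_⟩
    have h1 := tendsto_mul_stieltjes (integrable_of_moments hw)
    simp only [zero_add, pow_one] at h
    simpa using Complex.ofReal_injective (tendsto_nhds_unique h1 h)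
  | succ n ih =>
    intro w hw h
    have hi := integrable_of_moments hw
    have hinv : Tendsto (fun y : ℝ => (((y : ℂ) * Complex.I) ^ (n + 1))⁻¹) atTop (𝓝 0) := by
      rw [tendsto_zero_iff_norm_tendsto_zero]
      have h1 : Tendsto (fun y : ℝ => (y ^ (n + 1))⁻¹) atTop (𝓝 0) :=
        tendsto_inv_atTop_zero.comp (tendsto_pow_atTop n.succ_ne_zero)
      refine h1.congr' ?_
      filter_upwards [eventually_gt_atTop 0] with y hy
      simp [abs_of_pos hy]
    have h0 : ∫ t, w t = 0 := by
      have h1 := tendsto_mul_stieltjes hi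
      have h2 := hinv.mul h
      rw [zero_mul] at h2
      have h3 : Tendsto (fun y : ℝ => ((y : ℂ) * Complex.I) * stieltjes w (y * Complex.I)) atTop
          (𝓝 0) := by
        refine h2.congr' ?_
        filter_upwards [eventually_gt_atTop 0] with y hy
        have h3 : (y : ℂ) * Complex.I ≠ 0 := by
          simp [hy.ne']
        rw [pow_succ _ (n + 1)]
        field_simp
      exact Complex.ofReal_eq_zero.1 (tendsto_nhds_unique h1 h3)
    have hw' : ∀ k : ℕ, Integrable fun t => t ^ k * (t * w t) := fun k => by
      simpa only [pow_succ, mul_assoc] using hw (k + 1)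
    have h1 := ih (w := fun t => t * w t) hw' (h.congr' ?_)
    · constructor
      · rintro (_ | k) hk
        · simpa using h0
        · simpa only [pow_succ, mul_assoc] using h1.1 k (by omega)
      · simpa only [pow_succ, mul_assoc] using h1.2
    · filter_upwards [eventually_gt_atTop 0] with y hy
      rw [stieltjes_id_mul hi (by simpa using hy.ne'), h0]
      push_cast
      ring

lemma stieltjes_eval_X_sub_C_mul (hw : ∀ k : ℕ, Integrable fun t => t ^ k * w t) (p : ℝ[X])
    (a : ℝ) {z : ℂ} (hz : z.im ≠ 0) :
    stieltjes (fun t => ((X - C a) * p).eval t * w t) z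
      = (z - a) * stieltjes (fun t => p.eval t * w t) z - (∫ t, p.eval t * w t : ℝ) := by
  have hp := integrable_eval_mul hw p
  have hp1 : Integrable fun t => t * (p.eval t * w t) := by
    simpa using integrable_pow_mul_eval_mul hw p 1
  have h1 := stieltjes_id_mul hp hz
  have h2 : stieltjes (fun t => ((X - C a) * p).eval t * w t) z
      = stieltjes (fun t => t * (p.eval t * w t)) z
        - a * stieltjes (fun t => p.eval t * w t) z := by
    rw [stieltjes, stieltjes, stieltjes, ← integral_const_mul,
      ← integral_sub (integrable_div_sub (integrable_complex_ofReal hp1) hz)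
        ((integrable_div_sub (integrable_complex_ofReal hp) hz).const_mul _)]
    refine integral_congr_ae (Eventually.of_forall fun t => ?_)
    simp
    ring
  rw [h2, h1]
  ring

lemma stieltjes_eval_sub_C_mul (hw : ∀ k : ℕ, Integrable fun t => t ^ k * w t) (p q : ℝ[X])
    (b : ℝ) {z : ℂ} (hz : z.im ≠ 0) :
    stieltjes (fun t => (p - C b * q).eval t * w t) z
      = stieltjes (fun t => p.eval t * w t) z - b * stieltjes (fun t => q.eval t * w t) z := by
  rw [stieltjes, stieltjes, stieltjes, ← integral_const_mul,
    ← integral_sub (integrable_div_sub (integrable_complex_ofReal (integrable_eval_mul hw p)) hz)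
      ((integrable_div_sub (integrable_complex_ofReal (integrable_eval_mul hw q)) hz).const_mul _)]
  refine integral_congr_ae (Eventually.of_forall fun t => ?_)
  simp
  ring

end Moments

/-! ### Secondary polynomials -/

section Secondary

variable {w : ℝ → ℝ}

/-- The divided difference is a polynomial in `t` except at `t = x`, where division by zero gives
`0`; one point does not matter. -/
lemma integrable_divided_difference (hw : ∀ k : ℕ, Integrable fun t => t ^ k * w t) (p : ℝ[X])
    (x : ℝ) : Integrable fun t => (p.eval t - p.eval x) / (t - x) * w t := by
  obtain ⟨q, hq⟩ := X_sub_C_dvd_sub_C_eval (a := x) (p := p)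
  refine (integrable_eval_mul hw q).congr ?_
  filter_upwards [compl_mem_ae_iff.2 (measure_singleton x)] with t ht
  have h := congrArg (eval t) hq
  simp only [eval_sub, eval_C, eval_mul, eval_X] at h
  have : t - x ≠ 0 := sub_ne_zero.2 ht
  rw [h]
  field_simp

/-- This is the three-term recursion of the convergents up to the integral, which orthogonality
removes for all but the constant polynomial. -/
lemma secondaryPoly_X_sub_C_mul (hw : ∀ k : ℕ, Integrable fun t => t ^ k * w t) (p : ℝ[X])
    (a x : ℝ) : secondaryPoly w ((X - C a) * p) x
      = (x - a) * secondaryPoly w p x + ∫ t, p.eval t * w t := by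
  rw [secondaryPoly, secondaryPoly, ← integral_const_mul,
    ← integral_add ((integrable_divided_difference hw p x).const_mul _) (integrable_eval_mul hw p)]
  refine integral_congr_ae ?_
  filter_upwards [compl_mem_ae_iff.2 (measure_singleton x)] with t ht
  have : t - x ≠ 0 := sub_ne_zero.2 ht
  simp only [eval_sub, eval_C, eval_mul, eval_X]
  field_simp
  ring

lemma secondaryPoly_C_mul (w : ℝ → ℝ) (p : ℝ[X]) (c x : ℝ) :
    secondaryPoly w (C c * p) x = c * secondaryPoly w p x := by
  rw [secondaryPoly, secondaryPoly, ← integral_const_mul]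
  refine integral_congr_ae (Eventually.of_forall fun t => ?_)
  simp only [eval_C, eval_mul]
  ring

lemma secondaryPoly_sub (hw : ∀ k : ℕ, Integrable fun t => t ^ k * w t) (p q : ℝ[X]) (x : ℝ) :
    secondaryPoly w (p - q) x = secondaryPoly w p x - secondaryPoly w q x := by
  rw [secondaryPoly, secondaryPoly, secondaryPoly,
    ← integral_sub (integrable_divided_difference hw p x) (integrable_divided_difference hw q x)]
  refine integral_congr_ae (Eventually.of_forall fun t => ?_)
  simp only [eval_sub]
  ring

lemma secondaryPoly_one (w : ℝ → ℝ) (x : ℝ) : secondaryPoly w 1 x = 0 := by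
  simp [secondaryPoly]

end Secondary

/-! ### Continued fractions and their convergents -/

/-- The densities `M n` are the spectral densities of the successive tails of a continued
fraction with coefficients `a n`, `b n`. -/
structure IsTailSequence (M : ℕ → ℝ → ℝ) (a b : ℕ → ℝ) : Prop where
  nonneg : ∀ n t, 0 ≤ M n t
  moments : ∀ n k : ℕ, Integrable fun t => t ^ k * M n t
  mass : ∀ n, ∫ t, M n t = b n
  mass_pos : ∀ n, 0 < b n
  recursion : ∀ n (z : ℂ), z.im ≠ 0 →
    stieltjes (M n) z * (z - a n - stieltjes (M (n + 1)) z) = b n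

/-- The monic denominators of the convergents. -/
noncomputable def convergentDen (a b : ℕ → ℝ) : ℕ → ℝ[X]
  | 0 => 1
  | 1 => X - C (a 0)
  | n + 2 => (X - C (a (n + 1))) * convergentDen a b (n + 1) - C (b (n + 1)) * convergentDen a b n

/-- The numerators of the convergents. -/
noncomputable def convergentNum (a b : ℕ → ℝ) : ℕ → ℝ[X]
  | 0 => 0
  | 1 => C (b 0)
  | n + 2 => (X - C (a (n + 1))) * convergentNum a b (n + 1) - C (b (n + 1)) * convergentNum a b n

section Convergents

variable (a b : ℕ → ℝ)

lemma monic_convergentDen_and_natDegree (n : ℕ) :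
    ((convergentDen a b n).Monic ∧ (convergentDen a b n).natDegree = n) ∧
      ((convergentDen a b (n + 1)).Monic ∧ (convergentDen a b (n + 1)).natDegree = n + 1) := by
  induction n with
  | zero =>
    refine ⟨⟨monic_one, natDegree_one⟩, ?_⟩
    simp only [convergentDen, zero_add]
    exact ⟨monic_X_sub_C _, natDegree_X_sub_C _⟩
  | succ n ih =>
    refine ⟨ih.2, ?_⟩
    obtain ⟨⟨h1, d1⟩, h2, d2⟩ := ih
    have hm : ((X - C (a (n + 1))) * convergentDen a b (n + 1)).Monic :=
      (monic_X_sub_C _).mul h2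
    have hd : ((X - C (a (n + 1))) * convergentDen a b (n + 1)).natDegree = n + 2 := by
      rw [(monic_X_sub_C _).natDegree_mul h2, natDegree_X_sub_C, d2]; ring
    have hlt : (C (b (n + 1)) * convergentDen a b n).natDegree
        < ((X - C (a (n + 1))) * convergentDen a b (n + 1)).natDegree := by
      rw [hd]
      exact (natDegree_C_mul_le _ _).trans_lt (by omega)
    simp only [convergentDen]
    refine ⟨hm.sub_of_left (degree_lt_degree hlt), ?_⟩
    rw [natDegree_sub_eq_left_of_natDegree_lt hlt, hd]

lemma monic_convergentDen (n : ℕ) : (convergentDen a b n).Monic :=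
  (monic_convergentDen_and_natDegree a b n).1.1

lemma natDegree_convergentDen (n : ℕ) : (convergentDen a b n).natDegree = n :=
  (monic_convergentDen_and_natDegree a b n).1.2

/-- The Casoratian of two solutions of one three-term recursion: each step multiplies it by the next
`b`. -/
lemma convergent_det (n : ℕ) (x : ℝ) :
    (convergentNum a b (n + 1)).eval x * (convergentDen a b n).eval x
      - (convergentDen a b (n + 1)).eval x * (convergentNum a b n).eval x
      = ∏ i ∈ Finset.range (n + 1), b i := by
  induction n with
  | zero => simp [convergentNum, convergentDen]
  | succ n ih =>
    rw [Finset.prod_range_succ, ← ih]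
    simp only [convergentNum, convergentDen, eval_sub, eval_mul, eval_X, eval_C]
    ring

end Convergents

/-! ### Orthogonality and boundary values of the tails -/

namespace IsTailSequence

variable {M : ℕ → ℝ → ℝ} {a b : ℕ → ℝ} (h : IsTailSequence M a b)

include h

lemma integrable (n : ℕ) : Integrable (M n) := integrable_of_moments (h.moments n)

lemma mass_prod_pos (n : ℕ) : 0 < ∏ i ∈ Finset.range n, b i :=
  Finset.prod_pos fun i _ => h.mass_pos i

lemma prod_recursion (n : ℕ) {z : ℂ} (hz : z.im ≠ 0) :
    ∏ i ∈ Finset.range (n + 3), stieltjes (M i) z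
      = (z - a (n + 1)) * ∏ i ∈ Finset.range (n + 2), stieltjes (M i) z
        - b (n + 1) * ∏ i ∈ Finset.range (n + 1), stieltjes (M i) z := by
  rw [Finset.prod_range_succ _ (n + 2), Finset.prod_range_succ _ (n + 1), ← h.recursion (n + 1) z hz]
  ring

lemma tendsto_pow_mul_prod (n : ℕ) :
    Tendsto (fun y : ℝ => ((y : ℂ) * Complex.I) ^ n
      * ∏ i ∈ Finset.range n, stieltjes (M i) (y * Complex.I)) atTop
      (𝓝 ((∏ i ∈ Finset.range n, b i : ℝ) : ℂ)) := by
  have h1 : Tendsto (fun y : ℝ => ∏ i ∈ Finset.range n,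
      ((y : ℂ) * Complex.I) * stieltjes (M i) (y * Complex.I)) atTop
      (𝓝 (∏ i ∈ Finset.range n, (b i : ℂ))) :=
    tendsto_finsetProd _ fun i _ => by
      rw [← h.mass i]; exact tendsto_mul_stieltjes (h.integrable i)
  rw [← Complex.ofReal_prod] at h1
  refine h1.congr fun y => ?_
  rw [Finset.prod_mul_distrib, Finset.prod_const, Finset.card_range]

lemma moments_of_stieltjes_eq {n : ℕ} {p : ℝ[X]}
    (hp : ∀ z : ℂ, z.im ≠ 0 → stieltjes (fun t => p.eval t * M 0 t) z
      = ∏ i ∈ Finset.range (n + 1), stieltjes (M i) z) :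
    (∀ k < n, ∫ t, t ^ k * (p.eval t * M 0 t) = 0) ∧
      ∫ t, t ^ n * (p.eval t * M 0 t) = ∏ i ∈ Finset.range (n + 1), b i := by
  refine moments_of_tendsto_pow_mul_stieltjes (fun k => ?_) ?_
  · exact integrable_pow_mul_eval_mul (h.moments 0) p k
  · refine (h.tendsto_pow_mul_prod (n + 1)).congr' ?_
    filter_upwards [eventually_gt_atTop 0] with y hy
    rw [hp _ (by simpa using hy.ne')]

/-- The transform identity and orthogonality grow together: the identity at one index gives, by its
decay, that `p_{n+1} M_0` has mass zero, and this removes the extra term in the recursion for the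
next index. -/
lemma stieltjes_convergentDen (n : ℕ) :
    (∀ z : ℂ, z.im ≠ 0 → stieltjes (fun t => (convergentDen a b n).eval t * M 0 t) z
      = ∏ i ∈ Finset.range (n + 1), stieltjes (M i) z) ∧
    (∀ z : ℂ, z.im ≠ 0 → stieltjes (fun t => (convergentDen a b (n + 1)).eval t * M 0 t) z
      = ∏ i ∈ Finset.range (n + 2), stieltjes (M i) z) := by
  induction n with
  | zero =>
    refine ⟨fun z hz => by simp [convergentDen], fun z hz => ?_⟩
    have h1 := stieltjes_eval_X_sub_C_mul (h.moments 0) 1 (a 0) hz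
    rw [mul_one] at h1
    simp only [convergentDen, zero_add]
    rw [h1]
    simp only [eval_one, one_mul]
    rw [h.mass 0, ← h.recursion 0 z hz, Finset.prod_range_succ, Finset.prod_range_one]
    ring
  | succ n ih =>
    refine ⟨ih.2, fun z hz => ?_⟩
    have h0 : ∫ t, (convergentDen a b (n + 1)).eval t * M 0 t = 0 := by
      simpa using (h.moments_of_stieltjes_eq ih.2).1 0 n.succ_pos
    simp only [convergentDen]
    rw [stieltjes_eval_sub_C_mul (h.moments 0) _ _ _ hz,
      stieltjes_eval_X_sub_C_mul (h.moments 0) _ _ hz, h0, ih.1 z hz, ih.2 z hz,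
      h.prod_recursion n hz]
    simp

lemma integral_pow_mul_convergentDen (n : ℕ) :
    (∀ k < n, ∫ t, t ^ k * ((convergentDen a b n).eval t * M 0 t) = 0) ∧
      ∫ t, t ^ n * ((convergentDen a b n).eval t * M 0 t) = ∏ i ∈ Finset.range (n + 1), b i :=
  h.moments_of_stieltjes_eq (h.stieltjes_convergentDen n).1

lemma integral_convergentDen_mul {n : ℕ} {s : ℝ[X]} (hs : s.natDegree ≤ n) :
    ∫ t, (convergentDen a b n).eval t * s.eval t * M 0 t
      = s.coeff n * ∏ i ∈ Finset.range (n + 1), b i := by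
  have h1 : ∀ t, (convergentDen a b n).eval t * s.eval t * M 0 t
      = ∑ k ∈ Finset.range (n + 1), s.coeff k
        * (t ^ k * ((convergentDen a b n).eval t * M 0 t)) := by
    intro t
    rw [eval_eq_sum_range' (Nat.lt_succ_of_le hs), Finset.mul_sum, Finset.sum_mul]
    exact Finset.sum_congr rfl fun k _ => by ring
  simp_rw [h1]
  rw [integral_finsetSum]
  · simp_rw [integral_const_mul]
    rw [Finset.sum_range_succ, (h.integral_pow_mul_convergentDen n).2, Finset.sum_eq_zero, zero_add]
    intro k hk
    rw [(h.integral_pow_mul_convergentDen n).1 k (Finset.mem_range.1 hk), mul_zero]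
  · intro k _
    refine Integrable.const_mul ?_ _
    exact integrable_pow_mul_eval_mul (h.moments 0) _ k

lemma exists_orthonormalPolynomials : ∃ P : ℕ → ℝ[X], IsOrthonormalPolynomials (M 0) P := by
  set B : ℕ → ℝ := fun n => ∏ i ∈ Finset.range (n + 1), b i
  have hB : ∀ n, 0 < B n := fun n => h.mass_prod_pos _
  have hs : ∀ n, (Real.sqrt (B n))⁻¹ ≠ 0 := fun n => inv_ne_zero (Real.sqrt_pos.2 (hB n)).ne'
  refine ⟨fun n => C (Real.sqrt (B n))⁻¹ * convergentDen a b n, fun n => ?_, fun n m => ?_⟩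
  · rw [degree_C_mul (hs n), degree_eq_natDegree (monic_convergentDen a b n).ne_zero,
      natDegree_convergentDen]
  · have key : ∀ n m, m ≤ n → ∫ t, (convergentDen a b n).eval t * (convergentDen a b m).eval t
        * M 0 t = if n = m then B n else 0 := by
      intro n m hmn
      rw [h.integral_convergentDen_mul ((natDegree_convergentDen a b m).le.trans hmn)]
      split_ifs with hnm
      · subst hnm
        have := (monic_convergentDen a b n).coeff_natDegree
        rw [natDegree_convergentDen] at this
        rw [this, one_mul]
      · rw [coeff_eq_zero_of_natDegree_lt, zero_mul]
        rw [natDegree_convergentDen]; omega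
    have key2 : ∀ n m, ∫ t, (convergentDen a b n).eval t * (convergentDen a b m).eval t
        * M 0 t = if n = m then B n else 0 := by
      intro n m
      rcases le_total m n with hmn | hmn
      · exact key n m hmn
      · have := key m n hmn
        simp_rw [mul_comm (eval _ (convergentDen a b m))] at this
        rw [this]
        by_cases hnm : n = m
        · simp [hnm]
        · simp [hnm, Ne.symm hnm]
    have h3 : ∀ t, eval t (C (Real.sqrt (B n))⁻¹ * convergentDen a b n)
        * eval t (C (Real.sqrt (B m))⁻¹ * convergentDen a b m) * M 0 t
        = (Real.sqrt (B n))⁻¹ * (Real.sqrt (B m))⁻¹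
          * ((convergentDen a b n).eval t * (convergentDen a b m).eval t * M 0 t) := by
      intro t
      simp only [eval_mul, eval_C]
      ring
    simp_rw [h3]
    rw [integral_const_mul, key2]
    split_ifs with hnm
    · subst hnm
      rw [← mul_inv, Real.mul_self_sqrt (hB n).le, inv_mul_cancel₀ (hB n).ne']
    · rw [mul_zero]

omit h in
-- Since `P d` has exact degree `d`, subtracting a multiple of it lowers the degree of `s`; this is
-- induction along the basis `P 0, P 1, …`.
lemma integral_orthonormal_mul_eq_zero {w : ℝ → ℝ}
    (hw : ∀ k : ℕ, Integrable fun t => t ^ k * w t) {P : ℕ → ℝ[X]}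
    (hP : IsOrthonormalPolynomials w P) (n : ℕ) :
    ∀ d ≤ n, ∀ s : ℝ[X], s.degree < d → ∫ t, (P n).eval t * s.eval t * w t = 0 := by
  intro d
  induction d with
  | zero =>
    intro _ s hs
    have : s = 0 := by simpa using hs
    simp [this]
  | succ d ih =>
    intro hd s hs
    have hcoeff : (P d).coeff d ≠ 0 := by
      have h1 : (P d).natDegree = d := natDegree_eq_of_degree_eq_some (hP.degree_eq d)
      have h2 : (P d).leadingCoeff ≠ 0 := leadingCoeff_ne_zero.2 fun h0 => by
        have := hP.degree_eq d
        simp [h0] at this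
      rwa [leadingCoeff, h1] at h2
    set c := s.coeff d / (P d).coeff d
    set s' := s - C c * P d with hs'
    have hdeg : s'.degree < d := by
      rw [degree_lt_iff_coeff_zero]
      intro m hm
      rw [hs', coeff_sub, coeff_C_mul]
      rcases hm.eq_or_lt with rfl | hm
      · rw [div_mul_cancel₀ _ hcoeff, sub_self]
      · rw [coeff_eq_zero_of_degree_lt (n := m), coeff_eq_zero_of_degree_lt (p := P d)]
        · ring
        · rw [hP.degree_eq]; exact_mod_cast hm
        · exact hs.trans_le (by exact_mod_cast hm)
    have h1 : ∀ t, (P n).eval t * s.eval t * w t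
        = (P n).eval t * s'.eval t * w t + c * ((P n).eval t * (P d).eval t * w t) := by
      intro t
      rw [hs']
      simp only [eval_sub, eval_mul, eval_C]
      ring
    simp_rw [h1]
    rw [integral_add, integral_const_mul, hP.orthonormal, ih (by omega) s' hdeg, if_neg (by omega)]
    · ring
    · simpa using integrable_eval_mul hw (P n * s')
    · exact Integrable.const_mul (by simpa using integrable_eval_mul hw (P n * P d)) c

lemma orthonormal_eq_C_mul {P : ℕ → ℝ[X]} (hP : IsOrthonormalPolynomials (M 0) P) (n : ℕ) :
    ∃ c : ℝ, c ^ 2 * (∏ i ∈ Finset.range (n + 1), b i) = 1 ∧ P n = C c * convergentDen a b n := by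
  set c := (P n).coeff n with hc
  set r := P n - C c * convergentDen a b n with hr
  have hmonic : (convergentDen a b n).coeff n = 1 := by
    have := (monic_convergentDen a b n).coeff_natDegree
    rwa [natDegree_convergentDen] at this
  have hdeg : r.degree < n := by
    rw [degree_lt_iff_coeff_zero]
    intro m hm
    rw [hr, coeff_sub, coeff_C_mul]
    rcases hm.eq_or_lt with rfl | hm
    · rw [hmonic, mul_one, sub_self]
    · rw [coeff_eq_zero_of_natDegree_lt (p := convergentDen a b n),
        coeff_eq_zero_of_degree_lt (p := P n)]
      · ring
      · rw [hP.degree_eq]; exact_mod_cast hm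
      · rw [natDegree_convergentDen]; exact hm
  have hi : ∀ p q : ℝ[X], Integrable fun t => p.eval t * q.eval t * M 0 t := fun p q => by
    simpa using integrable_eval_mul (h.moments 0) (p * q)
  have hr0 : r = 0 := by
    by_contra hne
    have hd : r.natDegree < n := (natDegree_lt_iff_degree_lt hne).2 hdeg
    -- Tested against the convergent denominator of its own degree, `r` yields its leading
    -- coefficient times a positive product, although orthogonality makes the integral zero.
    have h1 := h.integral_convergentDen_mul (n := r.natDegree) (s := r) le_rfl
    have h2 : ∀ t, (convergentDen a b r.natDegree).eval t * r.eval t * M 0 t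
        = (P n).eval t * (convergentDen a b r.natDegree).eval t * M 0 t
          - c * ((convergentDen a b n).eval t * (convergentDen a b r.natDegree).eval t * M 0 t) := by
      intro t
      have : r.eval t = (P n).eval t - c * (convergentDen a b n).eval t := by
        rw [hr]; simp
      rw [this]; ring
    simp_rw [h2] at h1
    rw [integral_sub (hi _ _) ((hi _ _).const_mul c), integral_const_mul,
      integral_orthonormal_mul_eq_zero (h.moments 0) hP n n le_rfl,
      h.integral_convergentDen_mul, coeff_eq_zero_of_natDegree_lt] at h1
    · have h3 : r.coeff r.natDegree ≠ 0 := by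
        rw [coeff_natDegree]; exact leadingCoeff_ne_zero.2 hne
      have := mul_ne_zero h3 (h.mass_prod_pos (r.natDegree + 1)).ne'
      apply this
      rw [← h1]; ring
    · rw [natDegree_convergentDen]; exact hd
    · rw [natDegree_convergentDen]; exact hd.le
    · rw [degree_eq_natDegree (monic_convergentDen a b _).ne_zero, natDegree_convergentDen]
      exact_mod_cast hd
  have hPn : P n = C c * convergentDen a b n := sub_eq_zero.1 hr0
  refine ⟨c, ?_, hPn⟩
  have h1 := hP.orthonormal n n
  rw [if_pos rfl, hPn] at h1
  rw [← h1]
  have h2 : ∀ t, eval t (C c * convergentDen a b n) * eval t (C c * convergentDen a b n) * M 0 t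
      = c ^ 2 * ((convergentDen a b n).eval t * (convergentDen a b n).eval t * M 0 t) := by
    intro t
    simp only [eval_mul, eval_C]
    ring
  simp_rw [h2]
  rw [integral_const_mul, h.integral_convergentDen_mul (natDegree_convergentDen a b n).le, hmonic,
    one_mul]

lemma secondaryPoly_convergentDen (n : ℕ) (x : ℝ) :
    secondaryPoly (M 0) (convergentDen a b n) x = (convergentNum a b n).eval x ∧
      secondaryPoly (M 0) (convergentDen a b (n + 1)) x = (convergentNum a b (n + 1)).eval x := by
  induction n with
  | zero =>
    simp only [convergentDen, convergentNum]
    refine ⟨by rw [secondaryPoly_one, eval_zero], ?_⟩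
    have h1 := secondaryPoly_X_sub_C_mul (h.moments 0) 1 (a 0) x
    rw [mul_one, secondaryPoly_one] at h1
    rw [h1]
    simp [h.mass 0]
  | succ n ih =>
    refine ⟨ih.2, ?_⟩
    have h0 : ∫ t, (convergentDen a b (n + 1)).eval t * M 0 t = 0 := by
      simpa using (h.integral_pow_mul_convergentDen (n + 1)).1 0 n.succ_pos
    simp only [convergentDen, convergentNum]
    rw [secondaryPoly_sub (h.moments 0), secondaryPoly_X_sub_C_mul (h.moments 0),
      secondaryPoly_C_mul, ih.1, ih.2, h0]
    simp

lemma aeval_convergent (n : ℕ) {z : ℂ} (hz : z.im ≠ 0) :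
    (aeval z (convergentDen a b n) * stieltjes (M 0) z - aeval z (convergentNum a b n)
      = ∏ i ∈ Finset.range (n + 1), stieltjes (M i) z) ∧
    (aeval z (convergentDen a b (n + 1)) * stieltjes (M 0) z - aeval z (convergentNum a b (n + 1))
      = ∏ i ∈ Finset.range (n + 2), stieltjes (M i) z) := by
  induction n with
  | zero =>
    constructor
    · simp [convergentDen, convergentNum]
    · rw [Finset.prod_range_succ, Finset.prod_range_one]
      simp only [convergentDen, convergentNum, map_sub, aeval_X, aeval_C,
        Complex.coe_algebraMap]
      linear_combination h.recursion 0 z hz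
  | succ n ih =>
    refine ⟨ih.2, ?_⟩
    rw [h.prod_recursion n hz, ← ih.1, ← ih.2]
    simp only [convergentDen, convergentNum, map_sub, map_mul, aeval_X, aeval_C,
      Complex.coe_algebraMap]
    ring

/-- The vertical limit of `p_n S_0 - q_n` at a boundary point. -/
lemma tendsto_prod (n : ℕ) {x : ℝ} {s : ℂ}
    (hs : Tendsto (fun y : ℝ => stieltjes (M 0) (x - y * Complex.I)) (𝓝[>] 0) (𝓝 s)) :
    Tendsto (fun y : ℝ => ∏ i ∈ Finset.range (n + 1), stieltjes (M i) (x - y * Complex.I))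
      (𝓝[>] 0) (𝓝 ((((convergentDen a b n).eval x : ℝ) : ℂ) * s
        - (((convergentNum a b n).eval x : ℝ) : ℂ))) := by
  have hz : Tendsto (fun y : ℝ => (x : ℂ) - y * Complex.I) (𝓝[>] 0) (𝓝 (x : ℂ)) := by
    have hc : Continuous fun y : ℝ => (x : ℂ) - y * Complex.I := by fun_prop
    have := hc.tendsto 0
    simp only [Complex.ofReal_zero, zero_mul, sub_zero] at this
    exact this.mono_left nhdsWithin_le_nhds
  have hp : ∀ p : ℝ[X], Tendsto (fun y : ℝ => aeval ((x : ℂ) - y * Complex.I) p) (𝓝[>] 0)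
      (𝓝 ((p.eval x : ℝ) : ℂ)) := fun p => by
    have h1 := (p.continuous_aeval (A := ℂ)).tendsto (x : ℂ)
    have h2 : aeval (x : ℂ) p = ((p.eval x : ℝ) : ℂ) := by
      have := aeval_algebraMap_apply ℂ x p
      simpa [coe_aeval_eq_eval] using this
    rw [h2] at h1
    exact h1.comp hz
  refine (((hp _).mul hs).sub (hp _)).congr' ?_
  filter_upwards [self_mem_nhdsWithin] with y hy
  exact (h.aeval_convergent n (by simpa using (ne_of_gt hy))).1

/-- The boundary densities of the tails in terms of those of the whole continued fraction. -/
lemma im_limit_mul_normSq (n : ℕ) {x m : ℝ} {s : ℂ}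
    (hs : Tendsto (fun y : ℝ => stieltjes (M 0) (x - y * Complex.I)) (𝓝[>] 0) (𝓝 s))
    (hm : Tendsto (fun y : ℝ => (stieltjes (M (n + 1)) (x - y * Complex.I)).im) (𝓝[>] 0) (𝓝 m))
    (hd : (((convergentDen a b n).eval x : ℝ) : ℂ) * s
      - (((convergentNum a b n).eval x : ℝ) : ℂ) ≠ 0) :
    m * Complex.normSq ((((convergentDen a b n).eval x : ℝ) : ℂ) * s
        - (((convergentNum a b n).eval x : ℝ) : ℂ))
      = s.im * ∏ i ∈ Finset.range (n + 1), b i := by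
  -- `S_{n+1}` is the quotient of two consecutive products, hence a Möbius function of `S_0` with
  -- real coefficients whose determinant is `convergent_det`.
  have h1 := (h.tendsto_prod (n + 1) hs).div (h.tendsto_prod n hs) hd
  have h2 : Tendsto (fun y : ℝ => (stieltjes (M (n + 1)) (x - y * Complex.I)).im) (𝓝[>] 0)
      (𝓝 (((((convergentDen a b (n + 1)).eval x : ℝ) : ℂ) * s
        - (((convergentNum a b (n + 1)).eval x : ℝ) : ℂ))
        / ((((convergentDen a b n).eval x : ℝ) : ℂ) * s
        - (((convergentNum a b n).eval x : ℝ) : ℂ))).im) := by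
    refine ((Complex.continuous_im.tendsto _).comp h1).congr' ?_
    filter_upwards [self_mem_nhdsWithin] with y hy
    have hy : 0 < y := hy
    simp only [Function.comp_apply, Pi.div_apply]
    rw [Finset.prod_range_succ _ (n + 1), mul_div_cancel_left₀]
    refine Finset.prod_ne_zero_iff.2 fun i _ => stieltjes_ne_zero (h.integrable i) (h.nonneg i)
      ((h.mass i).symm ▸ h.mass_pos i) (by simpa using hy.ne')
  rw [tendsto_nhds_unique hm h2, ← convergent_det a b n x, Complex.div_im]
  have hN := Complex.normSq_pos.2 hd
  rw [sub_mul, div_mul_cancel₀ _ hN.ne', div_mul_cancel₀ _ hN.ne']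
  simp
  ring

lemma ae_limits :
    ∀ᵐ x : ℝ, ∃ s : ℂ,
      Tendsto (fun y : ℝ => stieltjes (M 0) (x - y * Complex.I)) (𝓝[>] 0) (𝓝 s) ∧
      s.im = Real.pi * M 0 x ∧
      ∀ n, Tendsto (fun y : ℝ => (stieltjes (M n) (x - y * Complex.I)).im) (𝓝[>] 0)
          (𝓝 (Real.pi * M n x)) ∧
        (((convergentDen a b n).eval x : ℝ) : ℂ) * s
          - (((convergentNum a b n).eval x : ℝ) : ℂ) ≠ 0 := by
  have h1 : ∀ᵐ x : ℝ, ∀ n, ∃ l,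
      Tendsto (fun y : ℝ => stieltjes (M n) (x - y * Complex.I)) (𝓝[>] 0) (𝓝 l) :=
    ae_all_iff.2 fun n => ae_exists_stieltjes_limit (h.integrable n) (h.nonneg n)
      ((h.mass n).symm ▸ h.mass_pos n)
  have h2 : ∀ᵐ x : ℝ, ∀ n,
      Tendsto (fun y : ℝ => (stieltjes (M n) (x - y * Complex.I)).im) (𝓝[>] 0)
        (𝓝 (Real.pi * M n x)) :=
    ae_all_iff.2 fun n => ae_tendsto_im_stieltjes (h.integrable n)
  filter_upwards [h1, h2] with x hx1 hx2
  choose l hl using hx1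
  -- If `S_n` tended to zero, the finite limit of `S_{n+1}` would make the left side of the
  -- recursion tend to zero, against `b_n > 0`.
  have hl0 : ∀ n, l n ≠ 0 := by
    intro n h0
    have hz : Tendsto (fun y : ℝ => (x : ℂ) - y * Complex.I) (𝓝[>] 0) (𝓝 (x : ℂ)) := by
      have hc : Continuous fun y : ℝ => (x : ℂ) - y * Complex.I := by fun_prop
      have := hc.tendsto 0
      simp only [Complex.ofReal_zero, zero_mul, sub_zero] at this
      exact this.mono_left nhdsWithin_le_nhds
    have h3 := (hl n).mul ((hz.sub_const (a n : ℂ)).sub (hl (n + 1)))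
    rw [h0, zero_mul] at h3
    have h4 : Tendsto (fun _ : ℝ => (b n : ℂ)) (𝓝[>] 0) (𝓝 0) := by
      refine h3.congr' ?_
      filter_upwards [self_mem_nhdsWithin] with y hy
      have hy : 0 < y := hy
      exact h.recursion n _ (by simpa using hy.ne')
    have := tendsto_nhds_unique h4 tendsto_const_nhds
    exact (h.mass_pos n).ne (Complex.ofReal_eq_zero.1 this.symm).symm
  refine ⟨l 0, hl 0, ?_, fun n => ⟨hx2 n, ?_⟩⟩
  · exact tendsto_nhds_unique ((Complex.continuous_im.tendsto _).comp (hl 0)) (hx2 0)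
  · rw [tendsto_nhds_unique (h.tendsto_prod n (hl 0)) (tendsto_finsetProd _ fun i _ => hl i)]
    exact Finset.prod_ne_zero_iff.2 fun i _ => hl0 i

omit h in
-- As `p_n` and `q_n` are real, vanishing forces `p_n = 0` and then `q_n = 0` at `x`, which the
-- determinant excludes.
lemma convergent_ne_zero_of_im_ne_zero (hb : ∀ n, 0 < b n) (n : ℕ) (x : ℝ) {s : ℂ}
    (hs : s.im ≠ 0) : (((convergentDen a b n).eval x : ℝ) : ℂ) * s
      - (((convergentNum a b n).eval x : ℝ) : ℂ) ≠ 0 := by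
  intro h0
  have him := congrArg Complex.im h0
  have hre := congrArg Complex.re h0
  simp only [Complex.sub_im, Complex.im_ofReal_mul, Complex.ofReal_im, sub_zero, Complex.zero_im,
    mul_eq_zero, hs, or_false] at him
  simp [him] at hre
  have hdet := convergent_det a b n x
  rw [him, hre, mul_zero, mul_zero, sub_zero] at hdet
  exact (Finset.prod_pos fun i _ => hb i).ne hdet

end IsTailSequence

/-! ### The substitution `t = ω²` -/

section Squares

lemma sq_le_coe_iff {c : EReal} (hc : 0 ≤ c) {x : ℝ} (hx : 0 ≤ x) :
    c ^ 2 ≤ x ↔ c ≤ (Real.sqrt x : ℝ) := by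
  induction c with
  | bot => simp at hc
  | top => simp [pow_two]
  | coe r =>
    have hr : 0 ≤ r := by exact_mod_cast hc
    rw [← EReal.coe_pow, EReal.coe_le_coe_iff, EReal.coe_le_coe_iff, Real.le_sqrt hr hx]

lemma coe_le_sq_iff {c : EReal} (hc : 0 ≤ c) {x : ℝ} :
    (x : EReal) ≤ c ^ 2 ↔ ((Real.sqrt x : ℝ) : EReal) ≤ c := by
  induction c with
  | bot => simp at hc
  | top => simp [pow_two]
  | coe r =>
    have hr : 0 ≤ r := by exact_mod_cast hc
    rw [← EReal.coe_pow, EReal.coe_le_coe_iff, EReal.coe_le_coe_iff, Real.sqrt_le_left hr]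

lemma sq_lt_sq_of_nonneg {a b : EReal} (ha : 0 ≤ a) (hab : a < b) : a ^ 2 < b ^ 2 := by
  induction a with
  | bot => simp at ha
  | top => simp at hab
  | coe r =>
    have hr : 0 ≤ r := by exact_mod_cast ha
    induction b with
    | bot => simp at hab
    | top =>
      rw [← EReal.coe_pow, pow_two ⊤, EReal.top_mul_top]
      exact EReal.coe_lt_top _
    | coe s =>
      rw [← EReal.coe_pow, ← EReal.coe_pow, EReal.coe_lt_coe_iff]
      have : r < s := by exact_mod_cast hab
      gcongr

lemma mem_realInterval_sq_iff {a b : EReal} (ha : 0 ≤ a) (hb : 0 ≤ b) {x : ℝ} :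
    x ∈ realInterval (a ^ 2) (b ^ 2) ↔ 0 ≤ x ∧ Real.sqrt x ∈ realInterval a b := by
  constructor
  · rintro ⟨h1, h2⟩
    have hx : 0 ≤ x := by
      have h3 : (0 : EReal) ≤ a ^ 2 := by rw [pow_two]; exact mul_nonneg ha ha
      exact_mod_cast h3.trans h1
    exact ⟨hx, (sq_le_coe_iff ha hx).1 h1, (coe_le_sq_iff hb).1 h2⟩
  · rintro ⟨hx, h1, h2⟩
    exact ⟨(sq_le_coe_iff ha hx).2 h1, (coe_le_sq_iff hb).2 h2⟩

lemma isClosed_realInterval (a b : EReal) : IsClosed (realInterval a b) :=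
  (isClosed_le continuous_const continuous_coe_real_ereal).inter
    (isClosed_le continuous_coe_real_ereal continuous_const)

/-- The square root is differentiable on `(0, ∞)` and so preserves null sets. This carries
almost-everywhere statements from `t` back to `ω`. -/
lemma volume_pos_sq_mem_eq_zero {N : Set ℝ} (hN : volume N = 0) :
    volume {ω : ℝ | 0 < ω ∧ ω ^ 2 ∈ N} = 0 := by
  have h1 : volume (Real.sqrt '' (N ∩ Set.Ioi 0)) = 0 := by
    refine addHaar_image_eq_zero_of_differentiableOn_of_addHaar_eq_zero volume ?_
      (measure_mono_null Set.inter_subset_left hN)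
    intro x hx
    have : x ≠ 0 := ne_of_gt hx.2
    exact (Real.hasDerivAt_sqrt this).differentiableAt.differentiableWithinAt
  refine measure_mono_null ?_ h1
  rintro ω ⟨h0, hω⟩
  exact ⟨ω ^ 2, ⟨hω, by have : 0 < ω ^ 2 := by positivity
                        exact this⟩, Real.sqrt_sq h0.le⟩

variable {E : Type*} [NormedAddCommGroup E] [NormedSpace ℝ E]

lemma setIntegral_Ioi_comp_sq (g : ℝ → E) :
    ∫ ω in Set.Ioi (0 : ℝ), (2 * ω) • g (ω ^ 2) = ∫ t in Set.Ioi (0 : ℝ), g t := by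
  rw [← integral_comp_rpow_Ioi_of_pos (g := g) (p := 2) two_pos]
  refine setIntegral_congr_fun measurableSet_Ioi fun ω _ => ?_
  norm_num

lemma integrableOn_Ioi_comp_sq_iff (g : ℝ → E) :
    IntegrableOn (fun ω => (2 * ω) • g (ω ^ 2)) (Set.Ioi (0 : ℝ)) ↔
      IntegrableOn g (Set.Ioi (0 : ℝ)) := by
  rw [← integrableOn_Ioi_comp_rpow_iff g (p := 2) two_ne_zero]
  refine integrableOn_congr_fun (fun ω _ => ?_) measurableSet_Ioi
  norm_num

lemma integral_eq_setIntegral_Ioi {g : ℝ → E} (hg : ∀ t < 0, g t = 0) :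
    ∫ t, g t = ∫ t in Set.Ioi (0 : ℝ), g t := by
  rw [← integral_Ici_eq_integral_Ioi, setIntegral_eq_integral_of_forall_compl_eq_zero]
  intro t ht
  exact hg t (by simpa using ht)

omit [NormedSpace ℝ E] in
lemma integrable_iff_integrableOn_Ioi {g : ℝ → E} (hg : ∀ t < 0, g t = 0) :
    Integrable g ↔ IntegrableOn g (Set.Ioi (0 : ℝ)) := by
  rw [← integrableOn_Ici_iff_integrableOn_Ioi, integrableOn_iff_integrable_of_support_subset]
  intro t ht
  by_contra h
  exact ht (hg t (by simpa using h))

end Squares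

/-! ### The measure attached to a spectral density -/

section Phonon

variable {J : ℝ → ℝ}

lemma phononDensity_of_neg (J : ℝ → ℝ) {t : ℝ} (ht : t < 0) : phononDensity J t = 0 :=
  if_neg ht.not_ge

lemma phononDensity_sq (J : ℝ → ℝ) {ω : ℝ} (hω : 0 ≤ ω) :
    phononDensity J (ω ^ 2) = J ω / Real.pi := by
  rw [phononDensity, if_pos (sq_nonneg ω), Real.sqrt_sq hω]

lemma integral_mul_phononDensity (J : ℝ → ℝ) (k : ℕ) :
    ∫ t, t ^ k * phononDensity J t
      = 2 / Real.pi * ∫ ω in Set.Ioi (0 : ℝ), J ω * ω ^ (2 * k + 1) := by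
  rw [integral_eq_setIntegral_Ioi fun t ht => by rw [phononDensity_of_neg J ht, mul_zero],
    ← setIntegral_Ioi_comp_sq, ← integral_const_mul]
  refine setIntegral_congr_fun measurableSet_Ioi fun ω hω => ?_
  simp only [phononDensity_sq J (le_of_lt hω), smul_eq_mul]
  ring

lemma integral_phononDensity (J : ℝ → ℝ) : ∫ t, phononDensity J t = couplingSq J := by
  simpa [couplingSq] using integral_mul_phononDensity J 0

lemma integral_id_mul_phononDensity (hJ : couplingSq J ≠ 0) :
    ∫ t, t * phononDensity J t = frequencySq J * couplingSq J := by
  have h := integral_mul_phononDensity J 1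
  simp only [pow_one, mul_one] at h
  rw [h, frequencySq]
  field_simp

lemma selfEnergy_eq (J : ℝ → ℝ) (z : ℂ) :
    selfEnergy J z = -stieltjes (phononDensity J) (z ^ 2) := by
  rw [stieltjes, integral_eq_setIntegral_Ioi fun t ht => by
      rw [phononDensity_of_neg J ht, Complex.ofReal_zero, zero_div],
    ← setIntegral_Ioi_comp_sq, selfEnergy, ← integral_const_mul, ← integral_neg]
  refine setIntegral_congr_fun measurableSet_Ioi fun ω hω => ?_
  simp only [phononDensity_sq J (le_of_lt hω), Complex.real_smul]
  rw [← neg_sub (z ^ 2), div_neg]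
  push_cast
  ring

lemma stieltjes_div (w : ℝ → ℝ) (c : ℝ) (z : ℂ) :
    stieltjes (fun t => w t / c) z = stieltjes w z / c := by
  rw [stieltjes, stieltjes, ← integral_div]
  refine integral_congr_ae (Eventually.of_forall fun t => ?_)
  simp only [Complex.ofReal_div]
  ring

lemma mem_support_densityMeasure_iff {w : ℝ → ℝ} (hw : Measurable w) {x : ℝ} :
    x ∈ (densityMeasure w).support ↔ ∀ U ∈ 𝓝 x, volume ({t | 0 < w t} ∩ U) ≠ 0 := by
  rw [Measure.mem_support_iff_forall]
  refine forall₂_congr fun U _ => ?_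
  rw [pos_iff_ne_zero, ne_eq, densityMeasure, withDensity_apply_eq_zero (by fun_prop)]
  simp

lemma IsGaplessMeasure.div_const {a b : EReal} {w : ℝ → ℝ} (h : IsGaplessMeasure a b w) {c : ℝ}
    (hc : 0 < c) : IsGaplessMeasure a b fun t => w t / c where
  lt := h.lt
  measurable := h.measurable.div_const c
  nonneg t := div_nonneg (h.nonneg t) hc.le
  eq_zero t ht := by rw [h.eq_zero t ht, zero_div]
  moments k := by simpa only [mul_div_assoc] using (h.moments k).div_const c
  support_eq := by
    rw [← h.support_eq]
    ext x
    rw [mem_support_densityMeasure_iff (h.measurable.div_const c),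
      mem_support_densityMeasure_iff h.measurable]
    simp only [div_pos_iff_of_pos_right hc]

lemma IsGaplessMeasure.integral_pos {a b : EReal} {w : ℝ → ℝ} (h : IsGaplessMeasure a b w) :
    0 < ∫ t, w t := by
  obtain ⟨x, hx1, hx2⟩ := EReal.lt_iff_exists_real_btwn.1 h.lt
  have hx : x ∈ (densityMeasure w).support := by
    rw [h.support_eq]
    exact ⟨hx1.le, hx2.le⟩
  have h1 := (mem_support_densityMeasure_iff h.measurable).1 hx Set.univ univ_mem
  rw [integral_pos_iff_support_of_nonneg h.nonneg (integrable_of_moments h.moments),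
    pos_iff_ne_zero]
  intro h0
  refine h1 (measure_mono_null ?_ h0)
  rintro t ⟨ht, -⟩
  exact ne_of_gt ht

namespace IsGaplessSpectralDensity

variable {ωmin ωmax : EReal} (h : IsGaplessSpectralDensity ωmin ωmax J)

include h

lemma nonneg_max : 0 ≤ ωmax := h.nonneg_min.trans h.lt.le

lemma nonneg_of_mem {ω : ℝ} (hω : ω ∈ realInterval ωmin ωmax) : 0 ≤ ω := by
  exact_mod_cast h.nonneg_min.trans hω.1

lemma eq_zero_of_neg {ω : ℝ} (hω : ω < 0) : J ω = 0 :=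
  h.eq_zero ω fun hmem => hω.not_ge (h.nonneg_of_mem hmem)

lemma isGaplessMeasure : IsGaplessMeasure (ωmin ^ 2) (ωmax ^ 2) (phononDensity J) where
  lt := sq_lt_sq_of_nonneg h.nonneg_min h.lt
  measurable := Measurable.ite measurableSet_Ici
    ((h.measurable.comp Real.continuous_sqrt.measurable).div_const _) measurable_const
  nonneg t := by
    unfold phononDensity
    split_ifs
    · exact div_nonneg (h.nonneg _) Real.pi_pos.le
    · exact le_rfl
  eq_zero t ht := by
    rw [mem_realInterval_sq_iff h.nonneg_min h.nonneg_max, not_and] at ht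
    unfold phononDensity
    split_ifs with h0
    · rw [h.eq_zero _ (ht h0), zero_div]
    · rfl
  moments k := by
    rw [integrable_iff_integrableOn_Ioi fun t ht => by rw [phononDensity_of_neg J ht, mul_zero],
      ← integrableOn_Ioi_comp_sq_iff]
    -- The Jacobian `2ω` turns the moment of order `k` into the moment of order `2k + 1` of `J`; the
    -- moment of order zero of `J` is never used.
    refine (((h.moments (2 * k + 1) (by omega)).const_mul (2 / Real.pi)).integrableOn).congr_fun
      (fun ω hω => ?_) measurableSet_Ioi
    simp only [phononDensity_sq J (le_of_lt hω), smul_eq_mul]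
    ring
  support_eq := by
    have hm : Measurable (phononDensity J) := Measurable.ite measurableSet_Ici
      ((h.measurable.comp Real.continuous_sqrt.measurable).div_const _) measurable_const
    ext x
    rw [mem_support_densityMeasure_iff hm]
    constructor
    · intro hx
      by_contra hmem
      refine hx _ ((isClosed_realInterval _ _).isOpen_compl.mem_nhds hmem) ?_
      rw [show {t | 0 < phononDensity J t} ∩ (realInterval (ωmin ^ 2) (ωmax ^ 2))ᶜ = ∅ from ?_,
        measure_empty]
      refine Set.eq_empty_iff_forall_notMem.2 fun t ⟨ht, hti⟩ => ?_
      have ht : 0 < phononDensity J t := ht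
      rw [Set.mem_compl_iff, mem_realInterval_sq_iff h.nonneg_min h.nonneg_max, not_and] at hti
      unfold phononDensity at ht
      split_ifs at ht with h0
      · rw [h.eq_zero _ (hti h0), zero_div] at ht
        exact lt_irrefl _ ht
      · exact lt_irrefl _ ht
    · intro hx U hU hN
      rw [mem_realInterval_sq_iff h.nonneg_min h.nonneg_max, ← h.support_eq,
        mem_support_densityMeasure_iff h.measurable] at hx
      have hV : (fun ω : ℝ => ω ^ 2) ⁻¹' U ∈ 𝓝 (Real.sqrt x) := by
        have hc : ContinuousAt (fun ω : ℝ => ω ^ 2) (Real.sqrt x) := by fun_prop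
        refine hc.preimage_mem_nhds ?_
        simpa [Real.sq_sqrt hx.1] using hU
      -- If `M > 0` only on a null part of `U`, then `J > 0` only on a null part of the preimage of
      -- `U`, up to the point `0`.
      refine hx.2 _ hV (measure_mono_null ?_
        (measure_union_null (volume_pos_sq_mem_eq_zero hN) (measure_singleton (0 : ℝ))))
      rintro ω ⟨hω, hωU⟩
      have hω : 0 < J ω := hω
      rcases lt_trichotomy ω 0 with h0 | h0 | h0
      · rw [h.eq_zero_of_neg h0] at hω
        exact absurd hω (lt_irrefl _)
      · exact Or.inr h0
      · refine Or.inl ⟨h0, ?_, hωU⟩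
        show 0 < phononDensity J (ω ^ 2)
        rw [phononDensity_sq J h0.le]
        exact div_pos hω Real.pi_pos

lemma couplingSq_pos : 0 < couplingSq J := by
  rw [← integral_phononDensity]
  exact h.isGaplessMeasure.integral_pos

/-- `J` vanishes on the negative axis, so continuity at `0` would give `J 0 = 0`. This excludes the
point where the substitution degenerates. -/
lemma pos_of_pos_of_continuousAt {ω : ℝ} (hω : 0 < J ω) (hc : ContinuousAt J ω) : 0 < ω := by
  have hmem : ω ∈ realInterval ωmin ωmax := by
    by_contra hmem
    rw [h.eq_zero ω hmem] at hω
    exact lt_irrefl _ hω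
  refine lt_of_le_of_ne (h.nonneg_of_mem hmem) ?_
  rintro rfl
  have h1 : Tendsto J (𝓝[<] 0) (𝓝 (J 0)) := hc.tendsto.mono_left nhdsWithin_le_nhds
  have h2 : Tendsto J (𝓝[<] 0) (𝓝 0) := by
    refine tendsto_const_nhds.congr' ?_
    filter_upwards [self_mem_nhdsWithin] with t ht
    exact (h.eq_zero_of_neg ht).symm
  exact hω.ne' (tendsto_nhds_unique h1 h2)

end IsGaplessSpectralDensity

lemma continuousAt_phononDensity {ω : ℝ} (hω : 0 < ω) (hc : ContinuousAt J ω) :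
    ContinuousAt (phononDensity J) (ω ^ 2) := by
  have h1 : ContinuousAt (fun t => J (Real.sqrt t) / Real.pi) (ω ^ 2) := by
    refine ContinuousAt.div_const (ContinuousAt.comp (g := J) ?_
      Real.continuous_sqrt.continuousAt) _
    rwa [Real.sqrt_sq hω.le]
  refine h1.congr ?_
  filter_upwards [lt_mem_nhds (show 0 < ω ^ 2 by positivity)] with t ht
  rw [phononDensity, if_pos ht.le]

/-- With `s = φ/2 + iJ`, the two squares are the squared real and imaginary parts of `p s - q`. -/
lemma residualDenominator_C_mul (J : ℝ → ℝ) (p : ℝ[X]) (c ω : ℝ) {s : ℂ}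
    (hre : reducer (phononDensity J) (ω ^ 2) / 2 = s.re) (him : J ω = s.im) :
    residualDenominator J (C c * p) ω = c ^ 2 * Complex.normSq (((p.eval (ω ^ 2) : ℝ) : ℂ) * s
      - ((secondaryPoly (phononDensity J) p (ω ^ 2) : ℝ) : ℂ)) := by
  rw [residualDenominator, hre, him, secondaryPoly_C_mul, Complex.normSq_apply]
  simp
  ring

end Phonon

/-! ### Residual densities -/

namespace IsResidualSequence

variable {ωmin ωmax : EReal} {J : ℕ → ℝ → ℝ} (h : IsResidualSequence ωmin ωmax J)

include h

lemma stieltjes_phononDensity (n : ℕ) {z : ℂ}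
    (hz : ∀ x ∈ realInterval (ωmin ^ 2) (ωmax ^ 2), z ≠ (x : ℂ)) :
    stieltjes (phononDensity (J n)) z
      = couplingSq (J n) / (z - frequencySq (J n) - stieltjes (phononDensity (J (n + 1))) z) := by
  -- The recursion is stated in the frequency variable, so it is read at a square root `u` of `z`;
  -- `±u` avoids the frequency interval because `u²` avoids its image.
  obtain ⟨u, rfl⟩ := IsAlgClosed.exists_pow_nat_eq z two_pos
  have hg := h.gapless n
  have hmem : ∀ ω ∈ realInterval ωmin ωmax, ω ^ 2 ∈ realInterval (ωmin ^ 2) (ωmax ^ 2) := by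
    intro ω hω
    rw [mem_realInterval_sq_iff hg.nonneg_min hg.nonneg_max, Real.sqrt_sq (hg.nonneg_of_mem hω)]
    exact ⟨sq_nonneg ω, hω⟩
  have h1 := h.recursion n u fun ω hω => ⟨?_, ?_⟩
  · rw [selfEnergy_eq, selfEnergy_eq] at h1
    rw [← neg_inj, h1, ← div_neg]
    congr 1
    ring
  · rintro rfl
    exact hz _ (hmem ω hω) (by push_cast; ring)
  · rintro rfl
    exact hz _ (hmem ω hω) (by push_cast; ring)

lemma isTailSequence : IsTailSequence (fun n => phononDensity (J n))
    (fun n => frequencySq (J n)) (fun n => couplingSq (J n)) where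
  nonneg n := (h.gapless n).isGaplessMeasure.nonneg
  moments n := (h.gapless n).isGaplessMeasure.moments
  mass n := integral_phononDensity _
  mass_pos n := (h.gapless n).couplingSq_pos
  recursion n z hz := by
    have hg := (h.gapless n).isGaplessMeasure
    have h1 := h.stieltjes_phononDensity n (z := z) fun x _ hx => hz (by rw [hx]; simp)
    have h2 := stieltjes_ne_zero (integrable_of_moments hg.moments) hg.nonneg hg.integral_pos hz
    -- A zero denominator would make the quotient `0` by convention, but the transform has no zeros
    -- off the real axis.
    have h3 : z - frequencySq (J n) - stieltjes (phononDensity (J (n + 1))) z ≠ 0 := by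
      intro h0
      rw [h0, div_zero] at h1
      exact h2 h1
    rw [h1, div_mul_cancel₀ _ h3]

lemma isNormalisedSecondarySequence :
    IsNormalisedSecondarySequence (ωmin ^ 2) (ωmax ^ 2)
      (fun n t => phononDensity (J n) t / couplingSq (J n)) where
  moment_zero := by
    simp only [moment, pow_zero, one_mul]
    rw [integral_div, integral_phononDensity, div_self (h.gapless 0).couplingSq_pos.ne']
  gapless n := (h.gapless n).isGaplessMeasure.div_const (h.gapless n).couplingSq_pos
  step n := by
    have hc := (h.gapless n).couplingSq_pos
    -- The unnormalised secondary density is the next phonon density itself, with mass `D_{n+1}²`.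
    refine ⟨phononDensity (J (n + 1)), ⟨(h.gapless n).isGaplessMeasure.div_const hc,
      (h.gapless (n + 1)).isGaplessMeasure, fun z hz => ?_⟩, fun x => ?_⟩
    · have hm : moment (fun t => phononDensity (J n) t / couplingSq (J n)) 1
          = frequencySq (J n) := by
        simp only [moment, pow_one, ← mul_div_assoc]
        rw [integral_div, integral_id_mul_phononDensity hc.ne', mul_div_cancel_right₀ _ hc.ne']
      have hc' : (couplingSq (J n) : ℂ) ≠ 0 := Complex.ofReal_ne_zero.2 hc.ne'
      -- At a real `z` off the interval the denominator may vanish; the double inversion is still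
      -- valid since the inverse of `0` is `0`.
      rw [stieltjes_div, hm, h.stieltjes_phononDensity n hz, div_div_cancel_left' hc', one_div,
        inv_inv]
      ring
    · simp only [moment, pow_zero, one_mul, integral_phononDensity]

/-- The formula for the residual densities at a frequency at which the boundary limits exist. -/
lemma formula_of_limits {P : ℕ → ℝ[X]} (hP : IsOrthonormalPolynomials (phononDensity (J 0)) P)
    (n : ℕ) {ω : ℝ} (hω : 0 < ω) {s : ℂ}
    (hs : Tendsto (fun y : ℝ => stieltjes (phononDensity (J 0)) ((ω ^ 2 : ℝ) - y * Complex.I))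
      (𝓝[>] 0) (𝓝 s)) (him : s.im = Real.pi * phononDensity (J 0) (ω ^ 2))
    (hm : Tendsto (fun y : ℝ => (stieltjes (phononDensity (J (n + 1)))
      ((ω ^ 2 : ℝ) - y * Complex.I)).im) (𝓝[>] 0)
      (𝓝 (Real.pi * phononDensity (J (n + 1)) (ω ^ 2))))
    (hd : (((convergentDen (fun n => frequencySq (J n)) (fun n => couplingSq (J n)) n).eval (ω ^ 2)
        : ℝ) : ℂ) * s
      - (((convergentNum (fun n => frequencySq (J n)) (fun n => couplingSq (J n)) n).eval (ω ^ 2)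
        : ℝ) : ℂ) ≠ 0) :
    residualDenominator (J 0) (P n) ω ≠ 0 ∧
      J (n + 1) ω = J 0 ω / residualDenominator (J 0) (P n) ω := by
  have ht := h.isTailSequence
  have hJ : ∀ k, Real.pi * phononDensity (J k) (ω ^ 2) = J k ω := fun k => by
    rw [phononDensity_sq _ hω.le, mul_div_cancel₀ _ Real.pi_ne_zero]
  obtain ⟨c, hc, hPn⟩ := ht.orthonormal_eq_C_mul hP n
  have hc0 : c ^ 2 ≠ 0 := left_ne_zero_of_mul (hc.symm ▸ one_ne_zero)
  have hden := residualDenominator_C_mul (J 0)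
    (convergentDen (fun n => frequencySq (J n)) (fun n => couplingSq (J n)) n) c ω
    (hasReducer_of_tendsto hs).2 (by rw [him, hJ])
  rw [(ht.secondaryPoly_convergentDen n _).1, ← hPn] at hden
  have hmain := ht.im_limit_mul_normSq n hs hm hd
  rw [hJ, him, hJ] at hmain
  have hN := Complex.normSq_pos.2 hd
  rw [hden]
  refine ⟨mul_ne_zero hc0 hN.ne', ?_⟩
  rw [eq_div_iff (mul_ne_zero hc0 hN.ne')]
  -- The normalisation `c² b_0 ⋯ b_n = 1` cancels the determinant.
  linear_combination c ^ 2 * hmain + J 0 ω * hc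

lemma ae_formula {P : ℕ → ℝ[X]} (hP : IsOrthonormalPolynomials (phononDensity (J 0)) P) :
    ∀ᵐ ω : ℝ, ω ∈ realInterval ωmin ωmax →
      HasReducer (phononDensity (J 0)) (ω ^ 2) ∧
      ∀ n : ℕ, 1 ≤ n → residualDenominator (J 0) (P (n - 1)) ω ≠ 0 ∧
        J n ω = J 0 ω / residualDenominator (J 0) (P (n - 1)) ω := by
  -- The exceptional null set in `t` pulls back to a null set of positive frequencies; the frequency
  -- `0` is discarded separately.
  have h1 := volume_pos_sq_mem_eq_zero (ae_iff.1 h.isTailSequence.ae_limits)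
  filter_upwards [compl_mem_ae_iff.2 h1, compl_mem_ae_iff.2 (measure_singleton (0 : ℝ))]
    with ω hω h0 hmem
  have hpos : 0 < ω := lt_of_le_of_ne ((h.gapless 0).nonneg_of_mem hmem) (Ne.symm h0)
  have h2 := not_not.1 fun hn => hω ⟨hpos, hn⟩
  obtain ⟨s, hs, him, hlim⟩ := h2
  refine ⟨(hasReducer_of_tendsto hs).1, fun n hn => ?_⟩
  obtain ⟨m, rfl⟩ : ∃ m, n = m + 1 := ⟨n - 1, by omega⟩
  exact h.formula_of_limits hP m hpos hs him (hlim (m + 1)).1 (hlim m).2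

lemma formula_of_continuousAt {P : ℕ → ℝ[X]}
    (hP : IsOrthonormalPolynomials (phononDensity (J 0)) P) {ω : ℝ} (hω : 0 < J 0 ω)
    (hc : ContinuousAt (J 0) ω) (hr : HasReducer (phononDensity (J 0)) (ω ^ 2)) (n : ℕ)
    (hcn : ContinuousAt (J (n + 1)) ω) :
    residualDenominator (J 0) (P n) ω ≠ 0 ∧
      J (n + 1) ω = J 0 ω / residualDenominator (J 0) (P n) ω := by
  have hpos := (h.gapless 0).pos_of_pos_of_continuousAt hω hc
  have hlim : ∀ k, ContinuousAt (J k) ω → Tendsto (fun y : ℝ =>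
      (stieltjes (phononDensity (J k)) ((ω ^ 2 : ℝ) - y * Complex.I)).im) (𝓝[>] 0)
      (𝓝 (Real.pi * phononDensity (J k) (ω ^ 2))) := fun k hk =>
    (isLebesguePoint_of_continuousAt (Complex.continuous_ofReal.continuousAt.comp
      (continuousAt_phononDensity hpos hk))).tendsto_im_stieltjes (h.isTailSequence.integrable k)
  have him : (((reducer (phononDensity (J 0)) (ω ^ 2) / 2 : ℝ) : ℂ)
      + ((Real.pi * phononDensity (J 0) (ω ^ 2) : ℝ) : ℂ) * Complex.I).im
      = Real.pi * phononDensity (J 0) (ω ^ 2) := by simp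
  refine h.formula_of_limits hP n hpos (tendsto_stieltjes_of_hasReducer hr (hlim 0 hc)) him
    (hlim _ hcn) (IsTailSequence.convergent_ne_zero_of_im_ne_zero h.isTailSequence.mass_pos _ _ ?_)
  rw [him, phononDensity_sq _ hpos.le, mul_div_cancel₀ _ Real.pi_ne_zero]
  exact hω.ne'

end IsResidualSequence

end ChainMapping

theorem mainTheorem6 (ωmin ωmax : EReal) (J : ℕ → ℝ → ℝ)
    (hJ : ChainMapping.IsResidualSequence ωmin ωmax J) :
    -- the normalised densities `J n (√t) / (π D_n²)` form a sequence of normalised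
    -- secondary measures
    ChainMapping.IsNormalisedSecondarySequence (ωmin ^ 2) (ωmax ^ 2)
        (fun n t => ChainMapping.phononDensity (J n) t / ChainMapping.couplingSq (J n)) ∧
    -- orthonormal polynomials of `λ¹` exist, and for any choice of them:
    (∃ P : ℕ → Polynomial ℝ,
      ChainMapping.IsOrthonormalPolynomials (ChainMapping.phononDensity (J 0)) P) ∧
    ∀ P : ℕ → Polynomial ℝ,
      ChainMapping.IsOrthonormalPolynomials (ChainMapping.phononDensity (J 0)) P →
      -- the formula at almost every frequency
      (∀ᵐ ω : ℝ, ω ∈ ChainMapping.realInterval ωmin ωmax →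
        ChainMapping.HasReducer (ChainMapping.phononDensity (J 0)) (ω ^ 2) ∧
        ∀ n : ℕ, 1 ≤ n →
          ChainMapping.residualDenominator (J 0) (P (n - 1)) ω ≠ 0 ∧
          J n ω = J 0 ω / ChainMapping.residualDenominator (J 0) (P (n - 1)) ω) ∧
      -- the formula at every frequency where the densities are continuous, `J 0` is positive
      -- and the reducer exists
      (∀ ω : ℝ, 0 < J 0 ω → ContinuousAt (J 0) ω →
        ChainMapping.HasReducer (ChainMapping.phononDensity (J 0)) (ω ^ 2) →
        ∀ n : ℕ, 1 ≤ n → ContinuousAt (J n) ω →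
          ChainMapping.residualDenominator (J 0) (P (n - 1)) ω ≠ 0 ∧
          J n ω = J 0 ω / ChainMapping.residualDenominator (J 0) (P (n - 1)) ω) := by
  refine ⟨hJ.isNormalisedSecondarySequence, hJ.isTailSequence.exists_orthonormalPolynomials,
    fun P hP => ⟨hJ.ae_formula hP, fun ω hω hc hr n hn hcn => ?_⟩⟩
  obtain ⟨m, rfl⟩ : ∃ m, n = m + 1 := ⟨n - 1, by omega⟩
  exact hJ.formula_of_continuousAt hP hω hc hr m hcn
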